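/- Let $R$ be a ring (associative, with $1$) and $R\text{-Mod}$ the category of left $R$-modules. Let $Q=A_\infty^\infty$ be the infinite line quiver $$\cdots \to \bullet_{1}\to\bullet_0\to\bullet_{-1}\to\bullet_{-2}\to\cdots$$ with vertex set $\mathbb{Z}$ and exactly one arrow $i\to i-1$ for each $i\in\mathbb{Z}$, and let $\mathrm{Rep}(Q,R)$ be the category of $R\text{-Mod}$-valued representations of $Q$. For a class $\mathcal F$ of objects of an abelian category put $\mathcal F^{\perp}=\{Y : \mathrm{Ext}^1(F,Y)=0\ \forall F\in\mathcal F\}$ and ${}^{\perp}\mathcal F=\{X : \mathrm{Ext}^1(X,F)=0\ \forall F\in\mathcal F\}$. A pair $(\mathcal A,\mathcal B)$ of classes is a cotorsion pair if $\mathcal A^\perp=\mathcal B$ and ${}^\perp\mathcal B=\mathcal A$. It is complete if for every object $X$ there are short exact sequences $0\to B\to A\to X\to 0$ and $0\to X\to B'\to A'\to 0$ with $A,A'\in\mathcal A$ and $B,B'\in\mathcal B$. It is hereditary if $\mathrm{Ext}^n(A,B)=0$ for all $n\ge 1$, $A\in\mathcal A$, $B\in\mathcal B$. For $X\in\mathrm{Rep}(Q,R)$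 and a vertex $i$ let $\varphi_i^X:\bigoplus_{a:j\to i}X(j)\to X(i)$ and $\psi_i^X:X(i)\to\prod_{a:i\to j}X(j)$ be the morphisms with components $X(a)$, where $a$ ranges over the arrows with target $i$, respectively with source $i$. For a class $\mathcal F$ of left $R$-modules put $$\Phi(\mathcal F)=\{X : \varphi_i^X \text{ is monic and } \mathrm{Coker}\,\varphi_i^X\in\mathcal F \text{ for all } i\},\qquad \Psi(\mathcal F)=\{X : \psi_i^X \text{ is epic and } \mathrm{Ker}\,\psi_i^X\in\mathcal F \text{ for all } i\}.$$ Theorem. Let $(\mathcal A,\mathcal B)$ be a complete hereditary cotorsion pair in $R\text{-Mod}$. Then $(\Phi(\mathcal A),\Phi(\mathcal A)^{\perp})$ and $({}^{\perp}\Psi(\mathcal B),\Psi(\mathcal B))$ are cotorsion pairs in $\mathrm{Rep}(Q,R)$, and both are complete and hereditary. -/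

import Mathlib

open CategoryTheory CategoryTheory.Limits

universe w v u v' u'

noncomputable section

namespace QuiverCotorsion

section Cotorsion

variable {C : Type u} [Category.{v} C] [Abelian C]

/-- The vanishing `Extⁿ(X, Y) = 0`. The `Ext`-groups are formed in a universe where they exist for
every abelian category; their vanishing does not depend on that universe. -/
def ExtVanishes (X Y : C) (n : ℕ) : Prop :=
  letI := HasExt.standard C
  Subsingleton (Abelian.Ext X Y n)

/-- The class `𝒜^⊥` of all `Y` with `Ext¹(A, Y) = 0` for all `A` in `𝒜`. -/
def rightPerp (𝒜 : ObjectProperty C) : ObjectProperty C :=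
  fun Y => ∀ A : C, 𝒜 A → ExtVanishes A Y 1

/-- The class `^⊥ℬ` of all `X` with `Ext¹(X, B) = 0` for all `B` in `ℬ`. -/
def leftPerp (ℬ : ObjectProperty C) : ObjectProperty C :=
  fun X => ∀ B : C, ℬ B → ExtVanishes X B 1

/-- `(𝒜, ℬ)` is a cotorsion pair: `𝒜^⊥ = ℬ` and `^⊥ℬ = 𝒜`. -/
structure IsCotorsionPair (𝒜 ℬ : ObjectProperty C) : Prop where
  rightPerp_eq : rightPerp 𝒜 = ℬ
  leftPerp_eq : leftPerp ℬ = 𝒜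

/-- `X` has a special `𝒜`-precover: a short exact sequence `0 → B → A → X → 0` with `A` in `𝒜` and
`B` in `ℬ`. -/
def HasSpecialPrecover (𝒜 ℬ : ObjectProperty C) (X : C) : Prop :=
  ∃ (B A : C) (i : B ⟶ A) (p : A ⟶ X) (h : i ≫ p = 0),
    𝒜 A ∧ ℬ B ∧ (ShortComplex.mk i p h).ShortExact

/-- `X` has a special `ℬ`-preenvelope: a short exact sequence `0 → X → B → A → 0` with `A` in `𝒜`
and `B` in `ℬ`. -/
def HasSpecialPreenvelope (𝒜 ℬ : ObjectProperty C) (X : C) : Prop :=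
  ∃ (B A : C) (i : X ⟶ B) (p : B ⟶ A) (h : i ≫ p = 0),
    𝒜 A ∧ ℬ B ∧ (ShortComplex.mk i p h).ShortExact

/-- Completeness of a pair `(𝒜, ℬ)`: every object has a special `𝒜`-precover (enough projectives)
and a special `ℬ`-preenvelope (enough injectives). -/
structure IsComplete (𝒜 ℬ : ObjectProperty C) : Prop where
  enoughProjectives : ∀ X : C, HasSpecialPrecover 𝒜 ℬ X
  enoughInjectives : ∀ X : C, HasSpecialPreenvelope 𝒜 ℬ X

/-- Heredity of a pair `(𝒜, ℬ)`: `Extⁿ(A, B) = 0` for all `n ≥ 1`, `A` in `𝒜` and `B` in `ℬ`. -/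
def IsHereditary (𝒜 ℬ : ObjectProperty C) : Prop :=
  ∀ n : ℕ, 1 ≤ n → ∀ A B : C, 𝒜 A → ℬ B → ExtVanishes A B n

/-- `(𝒜, ℬ)` is a cotorsion pair which is complete and hereditary. -/
structure IsCompleteHereditaryCotorsionPair (𝒜 ℬ : ObjectProperty C) : Prop where
  isCotorsionPair : IsCotorsionPair 𝒜 ℬ
  isComplete : IsComplete 𝒜 ℬ
  isHereditary : IsHereditary 𝒜 ℬ

end Cotorsion

section Representations

/-- `Rep(Q, C)`: the `C`-valued representations of the quiver `Q`, that is, the functors to `C` from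
the category of paths of `Q`. -/
abbrev QuiverRep (Q : Type u') [Quiver.{v'} Q] (C : Type u) [Category.{v} C] :=
  Paths Q ⥤ C

variable {Q : Type u'} [Quiver.{v'} Q] {C : Type u} [Category.{v} C]

/-- The value `X(i)` of a representation at a vertex. -/
abbrev vertexObj (X : QuiverRep Q C) (i : Q) : C := X.obj ((Paths.of Q).obj i)

/-- The value `X(a) : X(i) ⟶ X(j)` of a representation at an arrow `a : i ⟶ j`. -/
abbrev arrowMap (X : QuiverRep Q C) {i j : Q} (a : i ⟶ j) : vertexObj X i ⟶ vertexObj X j :=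
  X.map ((Paths.of Q).map a)

/-- The morphism `φᵢ : ⨁_{a : j → i} X(j) ⟶ X(i)`, the coproduct being over all arrows `a` with
target `i`, whose component at `a` is `X(a)`. -/
def phi [∀ i : Q, HasCoproductsOfShape (Quiver.Costar i) C] (X : QuiverRep Q C) (i : Q) :
    (∐ fun a : Quiver.Costar i => vertexObj X a.1) ⟶ vertexObj X i :=
  Sigma.desc fun a => arrowMap X a.2

/-- The morphism `ψᵢ : X(i) ⟶ ∏_{a : i → j} X(j)`, the product being over all arrows `a` with
source `i`, whose component at `a` is `X(a)`. -/
def psi [∀ i : Q, HasProductsOfShape (Quiver.Star i) C] (X : QuiverRep Q C) (i : Q) :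
    vertexObj X i ⟶ ∏ᶜ fun a : Quiver.Star i => vertexObj X a.1 :=
  Pi.lift fun a => arrowMap X a.2

variable [Abelian C]

/-- `Φ(ℱ)`: the representations such that, for all `i`, `φᵢ` is monic with cokernel in `ℱ`. -/
def Phi [∀ i : Q, HasCoproductsOfShape (Quiver.Costar i) C] (ℱ : ObjectProperty C) :
    ObjectProperty (QuiverRep Q C) :=
  fun X => ∀ i : Q, Mono (phi X i) ∧ ℱ (cokernel (phi X i))

/-- `Ψ(ℱ)`: the representations such that, for all `i`, `ψᵢ` is epic with kernel in `ℱ`. -/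
def Psi [∀ i : Q, HasProductsOfShape (Quiver.Star i) C] (ℱ : ObjectProperty C) :
    ObjectProperty (QuiverRep Q C) :=
  fun X => ∀ i : Q, Epi (psi X i) ∧ ℱ (kernel (psi X i))

end Representations

/-- The vertices of the infinite line quiver `⋯ → 1 → 0 → -1 → -2 → ⋯`. -/
def InfiniteLine : Type := ℤ

/-- There is exactly one arrow `i ⟶ j` if `i = j + 1`, and none otherwise. -/
instance : Quiver.{0} InfiniteLine where
  Hom := fun i j : ℤ => PLift (i = j + 1)

end QuiverCotorsion

end

/-! On the line every vertex has one incoming and one outgoing arrow, so `Phi 𝒜` is the class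
`filteredRep 𝒜` of representations whose maps X(j+1) → X(j) are monomorphisms with cokernel in 𝒜,
and `Psi ℬ` is the same kind of class for the opposite category and the reflected line. The
hypothesis is put in the self-dual form `HereditaryPair`, so one construction serves both halves.

By Salce's argument and dimension shifting, it suffices that filtered representations are closed
under retracts and kernels of epimorphisms, and that every X is a quotient of a filtered one with
kernel right orthogonal to them. Monomorphisms with cokernel in 𝒜 and epimorphisms with kernel in ℬ
form a weak factorization system (`llp_eq`, `rlp_eq`, `exists_factorization`), which gives retracts;
heredity and the snake lemma give kernels.

The cover F → X is built with the right lifting property against monomorphisms with filtered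
cokernel. A lift known at all vertices ≥ k extends down the arrows if the components below k are
epimorphisms with kernel in ℬ (`exists_lift_of_partialLift`). The difficulty is that the line has no
top vertex from which to start. Two constructions replace the start.

If X(i) embeds in E(i) ∈ ℬ, replacing X(j) by X(j) × ∏_{i>j} E(i) makes all maps monic, and lifts to
each E(i) start at vertex i (`exists_monomorphic_replacement`). If the maps of X are monic, then
X(n) ⊆ X(0) for n ≥ 0, and the tower X(0)/X(n) starts at 0. It is resolved recursively by a tower W'
in 𝒜; with L the pullback of X(0) and lim W' over lim X(0)/X(n), the kernels of L → W'(n) form the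
nonnegative part (`exists_nonnegative_cover`). The negative part comes from repeated factorization.
-/

noncomputable section

namespace QuiverCotorsion

/-! ### Vanishing of Ext and splitting of extensions -/

section ExtPackage

variable {C : Type u} [Category.{v} C] [Abelian C]

open Abelian

/-- Every extension `0 → B → E → A → 0` splits. -/
def ExtensionsSplit (A B : C) : Prop :=
  ∀ (E : C) (i : B ⟶ E) (p : E ⟶ A) (w : i ≫ p = 0), (ShortComplex.mk i p w).ShortExact →
    ∃ r : E ⟶ B, i ≫ r = 𝟙 B

lemma extVanishes_middle_left {S : ShortComplex C} (hS : S.ShortExact) {Y : C} {n : ℕ}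
    (h₁ : ExtVanishes S.X₁ Y n) (h₃ : ExtVanishes S.X₃ Y n) : ExtVanishes S.X₂ Y n := by
  have := HasExt.standard C
  refine subsingleton_of_forall_eq 0 fun x => ?_
  obtain ⟨y, rfl⟩ := Ext.contravariant_sequence_exact₂ hS _ x (h₁.elim _ _)
  rw [show y = 0 from h₃.elim _ _, Ext.comp_zero]

lemma extVanishes_left_of_middle {S : ShortComplex C} (hS : S.ShortExact) {Y : C} {n : ℕ}
    (h₂ : ExtVanishes S.X₂ Y n) (h₃ : ExtVanishes S.X₃ Y (n + 1)) : ExtVanishes S.X₁ Y n := by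
  have := HasExt.standard C
  refine subsingleton_of_forall_eq 0 fun x => ?_
  obtain ⟨y, rfl⟩ := Ext.contravariant_sequence_exact₁ hS _ x (add_comm 1 n) (h₃.elim _ _)
  rw [show y = 0 from h₂.elim _ _, Ext.comp_zero]

lemma extVanishes_right_of_left {S : ShortComplex C} (hS : S.ShortExact) {Y : C} {n : ℕ}
    (h₁ : ExtVanishes S.X₁ Y n) (h₂ : ExtVanishes S.X₂ Y (n + 1)) :
    ExtVanishes S.X₃ Y (n + 1) := by
  have := HasExt.standard C
  refine subsingleton_of_forall_eq 0 fun x => ?_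
  obtain ⟨y, rfl⟩ := Ext.contravariant_sequence_exact₃ hS _ x (h₂.elim _ _) (add_comm 1 n)
  rw [show y = 0 from h₁.elim _ _, Ext.comp_zero]

lemma extVanishes_middle_right {S : ShortComplex C} (hS : S.ShortExact) {X : C} {n : ℕ}
    (h₁ : ExtVanishes X S.X₁ n) (h₃ : ExtVanishes X S.X₃ n) : ExtVanishes X S.X₂ n := by
  have := HasExt.standard C
  refine subsingleton_of_forall_eq 0 fun x => ?_
  obtain ⟨y, rfl⟩ := Ext.covariant_sequence_exact₂ _ hS x (h₃.elim _ _)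
  rw [show y = 0 from h₁.elim _ _, Ext.zero_comp]

lemma extVanishes_quotient_of_middle {S : ShortComplex C} (hS : S.ShortExact) {X : C} {n : ℕ}
    (h₂ : ExtVanishes X S.X₂ n) (h₁ : ExtVanishes X S.X₁ (n + 1)) : ExtVanishes X S.X₃ n := by
  have := HasExt.standard C
  refine subsingleton_of_forall_eq 0 fun x => ?_
  obtain ⟨y, rfl⟩ := Ext.covariant_sequence_exact₃ _ hS x rfl (h₁.elim _ _)
  rw [show y = 0 from h₂.elim _ _, Ext.zero_comp]

lemma extVanishes_sub_of_quotient {S : ShortComplex C} (hS : S.ShortExact) {X : C} {n : ℕ}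
    (h₃ : ExtVanishes X S.X₃ n) (h₂ : ExtVanishes X S.X₂ (n + 1)) :
    ExtVanishes X S.X₁ (n + 1) := by
  have := HasExt.standard C
  refine subsingleton_of_forall_eq 0 fun x => ?_
  obtain ⟨y, rfl⟩ := Ext.covariant_sequence_exact₁ _ hS x (h₂.elim _ _) rfl
  rw [show y = 0 from h₃.elim _ _, Ext.zero_comp]

lemma extVanishes_of_projective (P Y : C) [Projective P] (n : ℕ) : ExtVanishes P Y (n + 1) := by
  have := HasExt.standard C
  exact Ext.subsingleton_of_projective P Y n

lemma extVanishes_of_injective (X I : C) [Injective I] (n : ℕ) : ExtVanishes X I (n + 1) := by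
  have := HasExt.standard C
  exact Ext.subsingleton_of_injective X I n

lemma extensionsSplit_of_extVanishes {A B : C} (h : ExtVanishes A B 1) : ExtensionsSplit A B := by
  have := HasExt.standard C
  intro E i p w hS
  obtain ⟨x, hx⟩ := Ext.contravariant_sequence_exact₁ hS B (Ext.mk₀ (𝟙 B)) (add_zero 1)
    (h.elim _ _)
  obtain ⟨r, rfl⟩ := (Ext.mk₀_bijective _ _).2 x
  rw [Ext.mk₀_comp_mk₀] at hx
  exact ⟨r, (Ext.mk₀_bijective _ _).1 hx⟩

/-- The pushout of a short exact sequence along a morphism out of its first object. -/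
lemma shortExact_pushout {S : ShortComplex C} (hS : S.ShortExact) {B : C} (g : S.X₁ ⟶ B) :
    (ShortComplex.mk (pushout.inr S.f g)
      (pushout.desc S.g 0 (S.zero.trans comp_zero.symm : S.f ≫ S.g = g ≫ 0))
      (pushout.inr_desc _ _ _)).ShortExact := by
  have := hS.mono_f
  have := hS.epi_g
  have hepi : Epi (pushout.desc S.g (0 : B ⟶ S.X₃)
      (S.zero.trans comp_zero.symm : S.f ≫ S.g = g ≫ 0)) := by
    have : Epi (pushout.inl S.f g ≫ pushout.desc S.g (0 : B ⟶ S.X₃)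
        (S.zero.trans comp_zero.symm : S.f ≫ S.g = g ≫ 0)) := by rwa [pushout.inl_desc]
    exact epi_of_epi (pushout.inl S.f g) _
  refine ⟨ShortComplex.exact_of_g_is_cokernel _ ?_⟩
  refine CokernelCofork.IsColimit.ofπ' _ _ fun k hk => ?_
  have h1 : S.f ≫ pushout.inl S.f g ≫ k = 0 := by
    rw [pushout.condition_assoc]
    dsimp at hk
    simp [hk]
  refine ⟨hS.exact.desc _ h1, pushout.hom_ext ?_ ?_⟩
  · exact (pushout.inl_desc_assoc _ _ _ _).trans (hS.exact.g_desc _ h1)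
  · exact (pushout.inr_desc_assoc _ _ _ _).trans (zero_comp.trans hk.symm)

/-- Every class in Ext¹(A, B) comes from a morphism f out of the kernel of a projective presentation
of A. If the pushout along f splits, then f extends to the projective and its class is zero. -/
lemma extVanishes_of_extensionsSplit [EnoughProjectives C] {A B : C} (h : ExtensionsSplit A B) :
    ExtVanishes A B 1 := by
  have := HasExt.standard C
  let S : ShortComplex C := ShortComplex.mk (kernel.ι (Projective.π A)) (Projective.π A) (by simp)
  have hS : S.ShortExact := ⟨ShortComplex.exact_of_f_is_kernel _ (kernelIsKernel _)⟩
  refine subsingleton_of_forall_eq 0 fun x => ?_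
  obtain ⟨y, rfl⟩ := Ext.contravariant_sequence_exact₃ hS _ x
    ((extVanishes_of_projective (Projective.over A) B 0).elim _ _) (add_zero 1)
  obtain ⟨f, rfl⟩ := (Ext.mk₀_bijective _ _).2 y
  obtain ⟨r, hr⟩ := h _ _ _ _ (shortExact_pushout hS f)
  have hf : f = S.f ≫ pushout.inl S.f f ≫ r := by
    rw [pushout.condition_assoc, hr, Category.comp_id]
  rw [hf, ← Ext.mk₀_comp_mk₀, hS.extClass_comp_assoc]

end ExtPackage

/-! ### Salce's lemma and dimension shifting -/

section Salce

variable {C : Type u} [Category.{v} C] [Abelian C]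

lemma shortExact_projectivePresentation [EnoughProjectives C] (X : C) :
    (ShortComplex.mk (kernel.ι (Projective.π X)) (Projective.π X) (by simp)).ShortExact :=
  ⟨ShortComplex.exact_of_f_is_kernel _ (kernelIsKernel _)⟩

lemma shortExact_injectivePresentation [EnoughInjectives C] (X : C) :
    (ShortComplex.mk (Injective.ι X) (cokernel.π (Injective.ι X)) (by simp)).ShortExact :=
  ⟨ShortComplex.exact_of_g_is_cokernel _ (cokernelIsCokernel _)⟩

/-- The pullback of a short exact sequence along a morphism into its last object. -/
lemma shortExact_pullback {S : ShortComplex C} (hS : S.ShortExact) {B : C} (g : B ⟶ S.X₃) :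
    (ShortComplex.mk (pullback.lift S.f 0 (S.zero.trans zero_comp.symm : S.f ≫ S.g = 0 ≫ g))
      (pullback.snd S.g g) (pullback.lift_snd _ _ _)).ShortExact := by
  have := hS.mono_f
  have := hS.epi_g
  have hmono : Mono (pullback.lift S.f (0 : S.X₁ ⟶ B)
      (S.zero.trans zero_comp.symm : S.f ≫ S.g = 0 ≫ g)) := by
    have : Mono (pullback.lift S.f (0 : S.X₁ ⟶ B)
        (S.zero.trans zero_comp.symm : S.f ≫ S.g = 0 ≫ g) ≫
        pullback.fst S.g g) := by rwa [pullback.lift_fst]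
    exact mono_of_mono _ (pullback.fst S.g g)
  refine ⟨ShortComplex.exact_of_f_is_kernel _ ?_⟩
  refine KernelFork.IsLimit.ofι' _ _ fun k hk => ?_
  dsimp at k hk
  have h1 : (k ≫ pullback.fst S.g g) ≫ S.g = 0 := by
    rw [Category.assoc, pullback.condition, reassoc_of% hk, zero_comp]
  refine ⟨hS.exact.lift _ h1, pullback.hom_ext ?_ ?_⟩
  · rw [Category.assoc]
    exact (congrArg _ (pullback.lift_fst _ _ _)).trans (hS.exact.lift_f _ h1)
  · rw [Category.assoc]
    exact (congrArg _ (pullback.lift_snd _ _ _)).trans (comp_zero.trans hk.symm)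

lemma extVanishes_of_retract_left {X Y Z : C} {n : ℕ} (i : X ⟶ Y) (r : Y ⟶ X) (h : i ≫ r = 𝟙 X)
    (hY : ExtVanishes Y Z n) : ExtVanishes X Z n := by
  have := HasExt.standard C
  refine subsingleton_of_forall_eq 0 fun x => ?_
  rw [← Abelian.Ext.mk₀_id_comp x, ← h, ← Abelian.Ext.mk₀_comp_mk₀_assoc,
    show (Abelian.Ext.mk₀ r).comp x (zero_add n) = 0 from hY.elim _ _, Abelian.Ext.comp_zero]

lemma extVanishes_of_retract_right {X Y Z : C} {n : ℕ} (i : X ⟶ Y) (r : Y ⟶ X) (h : i ≫ r = 𝟙 X)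
    (hY : ExtVanishes Z Y n) : ExtVanishes Z X n := by
  have := HasExt.standard C
  refine subsingleton_of_forall_eq 0 fun x => ?_
  have : x = (x.comp (Abelian.Ext.mk₀ i) (add_zero n)).comp (Abelian.Ext.mk₀ r) (add_zero n) := by
    rw [Abelian.Ext.comp_assoc_of_third_deg_zero, Abelian.Ext.mk₀_comp_mk₀, h,
      Abelian.Ext.comp_mk₀_id]
  rw [this, show x.comp (Abelian.Ext.mk₀ i) (add_zero n) = 0 from hY.elim _ _,
    Abelian.Ext.zero_comp]

/-- A class with special precovers which is closed under retracts and kernels of epimorphisms is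
the left half of a complete hereditary cotorsion pair. -/
theorem isCompleteHereditaryCotorsionPair_of_precovers [EnoughProjectives C] [EnoughInjectives C]
    (ℱ : ObjectProperty C)
    (hretract : ∀ (X Y : C) (i : X ⟶ Y) (r : Y ⟶ X), i ≫ r = 𝟙 X → ℱ Y → ℱ X)
    (hker : ∀ S : ShortComplex C, S.ShortExact → ℱ S.X₂ → ℱ S.X₃ → ℱ S.X₁)
    (hpre : ∀ X, HasSpecialPrecover ℱ (rightPerp ℱ) X) :
    IsCompleteHereditaryCotorsionPair ℱ (rightPerp ℱ) := by
  have hleft : leftPerp (rightPerp ℱ) = ℱ := by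
    ext X
    refine ⟨fun hX => ?_, fun hX Y hY => hY X hX⟩
    obtain ⟨K, P, i, p, w, hP, hK, hS⟩ := hpre X
    obtain ⟨r, hr⟩ := extensionsSplit_of_extVanishes (hX K hK) _ _ _ _ hS
    have := hS.epi_g
    have σ := ShortComplex.Splitting.ofExactOfRetraction _ hS.exact r hr this
    exact hretract X P σ.s p σ.s_g hP
  have hproj : ∀ P : C, Projective P → ℱ P := fun P _ => by
    rw [← hleft]
    exact fun Y _ => extVanishes_of_projective P Y 0
  refine ⟨⟨rfl, hleft⟩, ⟨hpre, fun X => ?_⟩, fun n hn => ?_⟩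
  -- Salce's trick: the pullback of X → I → I/X along a precover of I/X is an extension of the
  -- injective I by K, hence lies in the right orthogonal class.
  · obtain ⟨K, P, i, p, w, hP, hK, hS⟩ := hpre (cokernel (Injective.ι X))
    have hX := shortExact_injectivePresentation X
    have e₁ := shortExact_pullback hX p
    have e₂ := shortExact_pullback hS (cokernel.π (Injective.ι X))
    refine ⟨_, P, _, _, _, hP, fun A hA => ?_, e₁⟩
    have hmid := extVanishes_middle_right (X := A) (n := 1) e₂ (hK A hA)
      (extVanishes_of_injective A _ 0)
    exact extVanishes_of_retract_right (pullbackSymmetry _ _).hom (pullbackSymmetry _ _).inv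
      (by simp) hmid
  · obtain ⟨n, rfl⟩ : ∃ m, n = m + 1 := ⟨n - 1, by omega⟩
    clear hn
    induction n with
    | zero => exact fun A B hA hB => hB A hA
    | succ n ih =>
      intro A B hA hB
      have hS := shortExact_projectivePresentation A
      -- The syzygy of A stays in ℱ by closure under kernels, so the degree drops by one.
      exact extVanishes_right_of_left hS
        (ih _ B (hker _ hS (hproj _ inferInstance) hA) hB) (extVanishes_of_projective _ _ _)

/-- A class with special preenvelopes which is closed under retracts and cokernels of monomorphisms
is the right half of a complete hereditary cotorsion pair. -/
theorem isCompleteHereditaryCotorsionPair_of_preenvelopes [EnoughProjectives C]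
    [EnoughInjectives C] (ℱ : ObjectProperty C)
    (hretract : ∀ (X Y : C) (i : X ⟶ Y) (r : Y ⟶ X), i ≫ r = 𝟙 X → ℱ Y → ℱ X)
    (hcoker : ∀ S : ShortComplex C, S.ShortExact → ℱ S.X₁ → ℱ S.X₂ → ℱ S.X₃)
    (hpre : ∀ X, HasSpecialPreenvelope (leftPerp ℱ) ℱ X) :
    IsCompleteHereditaryCotorsionPair (leftPerp ℱ) ℱ := by
  have hright : rightPerp (leftPerp ℱ) = ℱ := by
    ext X
    refine ⟨fun hX => ?_, fun hX Y hY => hY X hX⟩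
    obtain ⟨P, K, i, p, w, hK, hP, hS⟩ := hpre X
    obtain ⟨r, hr⟩ := extensionsSplit_of_extVanishes (hX K hK) _ _ _ _ hS
    exact hretract X P i r hr hP
  have hinj : ∀ P : C, Injective P → ℱ P := fun P _ => by
    rw [← hright]
    exact fun Y _ => extVanishes_of_injective Y P 0
  refine ⟨⟨hright, rfl⟩, ⟨fun X => ?_, hpre⟩, fun n hn => ?_⟩
  · obtain ⟨P, K, i, p, w, hK, hP, hS⟩ := hpre (kernel (Projective.π X))
    have hX := shortExact_projectivePresentation X
    have e₁ := shortExact_pushout hX i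
    have e₂ := shortExact_pushout hS (kernel.ι (Projective.π X))
    refine ⟨P, _, _, _, _, fun B hB => ?_, hP, e₁⟩
    have hmid := extVanishes_middle_left (Y := B) (n := 1) e₂
      (extVanishes_of_projective _ _ 0) (hK B hB)
    exact extVanishes_of_retract_left (pushoutSymmetry _ _).hom (pushoutSymmetry _ _).inv
      (by simp) hmid
  · obtain ⟨n, rfl⟩ : ∃ m, n = m + 1 := ⟨n - 1, by omega⟩
    clear hn
    induction n with
    | zero => exact fun A B hA hB => hA B hB
    | succ n ih =>
      intro A B hA hB
      have hS := shortExact_injectivePresentation B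
      exact extVanishes_sub_of_quotient hS
        (ih A _ hA (hcoker _ hS hB (hinj _ inferInstance))) (extVanishes_of_injective _ _ _)

end Salce

open scoped ZeroObject

/-! ### The weak factorization system of a hereditary cotorsion pair -/

section HereditaryPair

variable {C : Type u} [Category.{v} C] [Abelian C]

/-- A complete hereditary cotorsion pair, described in terms of splittings of extensions and of
closure properties, so that the description is visibly self-dual. -/
structure HereditaryPair (𝒜 ℬ : ObjectProperty C) : Prop where
  left_iff (X : C) : 𝒜 X ↔ ∀ B, ℬ B → ExtensionsSplit X B
  right_iff (Y : C) : ℬ Y ↔ ∀ A, 𝒜 A → ExtensionsSplit A Y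
  precover (X : C) : HasSpecialPrecover 𝒜 ℬ X
  preenvelope (X : C) : HasSpecialPreenvelope 𝒜 ℬ X
  left_kernel (S : ShortComplex C) : S.ShortExact → 𝒜 S.X₂ → 𝒜 S.X₃ → 𝒜 S.X₁
  right_cokernel (S : ShortComplex C) : S.ShortExact → ℬ S.X₁ → ℬ S.X₂ → ℬ S.X₃

/-- Beyond degree one, heredity enters only through Ext² = 0, which yields the two closure
properties by the long exact sequences. -/
lemma IsCompleteHereditaryCotorsionPair.hereditaryPair [EnoughProjectives C]
    {𝒜 ℬ : ObjectProperty C} (h : IsCompleteHereditaryCotorsionPair 𝒜 ℬ) :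
    HereditaryPair 𝒜 ℬ where
  left_iff X := by
    refine ⟨fun hX B hB => extensionsSplit_of_extVanishes (h.isHereditary 1 le_rfl X B hX hB),
      fun hX => ?_⟩
    rw [← h.isCotorsionPair.leftPerp_eq]
    exact fun B hB => extVanishes_of_extensionsSplit (hX B hB)
  right_iff Y := by
    refine ⟨fun hY A hA => extensionsSplit_of_extVanishes (h.isHereditary 1 le_rfl A Y hA hY),
      fun hY => ?_⟩
    rw [← h.isCotorsionPair.rightPerp_eq]
    exact fun A hA => extVanishes_of_extensionsSplit (hY A hA)
  precover := h.isComplete.enoughProjectives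
  preenvelope := h.isComplete.enoughInjectives
  left_kernel S hS h₂ h₃ := by
    rw [← h.isCotorsionPair.leftPerp_eq]
    exact fun B hB => extVanishes_left_of_middle hS (h.isHereditary 1 le_rfl _ B h₂ hB)
      (h.isHereditary 2 one_le_two _ B h₃ hB)
  right_cokernel S hS h₁ h₂ := by
    rw [← h.isCotorsionPair.rightPerp_eq]
    exact fun A hA => extVanishes_quotient_of_middle hS (h.isHereditary 1 le_rfl A _ hA h₂)
      (h.isHereditary 2 one_le_two A _ hA h₁)

lemma ExtensionsSplit.exists_section {A B : C} (h : ExtensionsSplit A B) {E : C} {i : B ⟶ E}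
    {p : E ⟶ A} {w : i ≫ p = 0} (hS : (ShortComplex.mk i p w).ShortExact) :
    ∃ s : A ⟶ E, s ≫ p = 𝟙 A := by
  obtain ⟨r, hr⟩ := h _ _ _ _ hS
  exact ⟨_, (ShortComplex.Splitting.ofExactOfRetraction _ hS.exact r hr hS.epi_g).s_g⟩

lemma extensionsSplit_of_exists_section {A B : C}
    (h : ∀ (E : C) (i : B ⟶ E) (p : E ⟶ A) (w : i ≫ p = 0), (ShortComplex.mk i p w).ShortExact →
      ∃ s : A ⟶ E, s ≫ p = 𝟙 A) : ExtensionsSplit A B := by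
  intro E i p w hS
  obtain ⟨s, hs⟩ := h _ _ _ _ hS
  exact ⟨_, (ShortComplex.Splitting.ofExactOfSection _ hS.exact s hs hS.mono_f).f_r⟩

lemma ExtensionsSplit.op {A B : C} (h : ExtensionsSplit A B) :
    ExtensionsSplit (Opposite.op B) (Opposite.op A) := by
  intro E i p w hS
  obtain ⟨s, hs⟩ := h.exists_section hS.unop
  exact ⟨s.op, Quiver.Hom.unop_inj hs⟩

lemma ExtensionsSplit.unop {A B : C} (h : ExtensionsSplit (Opposite.op B) (Opposite.op A)) :
    ExtensionsSplit A B := by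
  intro E i p w hS
  obtain ⟨s, hs⟩ := h.exists_section hS.op
  exact ⟨s.unop, Quiver.Hom.op_inj hs⟩

lemma HereditaryPair.op {𝒜 ℬ : ObjectProperty C} (h : HereditaryPair 𝒜 ℬ) :
    HereditaryPair ℬ.op 𝒜.op where
  left_iff X := (h.right_iff X.unop).trans
    ⟨fun hX B hB => (hX B.unop hB).op, fun hX B hB => (hX (Opposite.op B) hB).unop⟩
  right_iff X := (h.left_iff X.unop).trans
    ⟨fun hX B hB => (hX B.unop hB).op, fun hX B hB => (hX (Opposite.op B) hB).unop⟩
  precover X := by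
    obtain ⟨B, A, i, p, w, hA, hB, hS⟩ := h.preenvelope X.unop
    exact ⟨_, _, p.op, i.op, _, hB, hA, hS.op⟩
  preenvelope X := by
    obtain ⟨B, A, i, p, w, hA, hB, hS⟩ := h.precover X.unop
    exact ⟨_, _, p.op, i.op, _, hB, hA, hS.op⟩
  left_kernel S hS h₂ h₃ := h.right_cokernel _ hS.unop h₃ h₂
  right_cokernel S hS h₁ h₂ := h.left_kernel _ hS.unop h₂ h₁

/-- The monomorphisms with cokernel in `𝒜`. -/
def monoWithCokernel (𝒜 : ObjectProperty C) : MorphismProperty C :=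
  fun _ _ f => Mono f ∧ 𝒜 (cokernel f)

/-- The epimorphisms with kernel in `ℬ`. -/
def epiWithKernel (ℬ : ObjectProperty C) : MorphismProperty C :=
  fun _ _ f => Epi f ∧ ℬ (kernel f)

lemma shortExact_cokernel {X Y : C} (f : X ⟶ Y) [Mono f] :
    (ShortComplex.mk f (cokernel.π f) (by simp)).ShortExact :=
  ⟨ShortComplex.exact_of_g_is_cokernel _ (cokernelIsCokernel _)⟩

lemma shortExact_kernel {X Y : C} (f : X ⟶ Y) [Epi f] :
    (ShortComplex.mk (kernel.ι f) f (by simp)).ShortExact :=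
  ⟨ShortComplex.exact_of_f_is_kernel _ (kernelIsKernel _)⟩

lemma monoWithCokernel_of_shortExact {𝒜 : ObjectProperty C} [𝒜.IsClosedUnderIsomorphisms]
    {S : ShortComplex C} (hS : S.ShortExact) (h : 𝒜 S.X₃) : monoWithCokernel 𝒜 S.f := by
  have := hS.epi_g
  have := hS.mono_f
  exact ⟨this, 𝒜.prop_of_iso
    (IsColimit.coconePointUniqueUpToIso hS.exact.gIsCokernel (colimit.isColimit _)) h⟩

lemma epiWithKernel_of_shortExact {ℬ : ObjectProperty C} [ℬ.IsClosedUnderIsomorphisms]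
    {S : ShortComplex C} (hS : S.ShortExact) (h : ℬ S.X₁) : epiWithKernel ℬ S.g := by
  have := hS.mono_f
  have := hS.epi_g
  exact ⟨this, ℬ.prop_of_iso
    (IsLimit.conePointUniqueUpToIso hS.exact.fIsKernel (limit.isLimit _)) h⟩

lemma prop_of_shortExact_of_monoWithCokernel {𝒜 : ObjectProperty C} [𝒜.IsClosedUnderIsomorphisms]
    {S : ShortComplex C} (hS : S.ShortExact) (h : monoWithCokernel 𝒜 S.f) : 𝒜 S.X₃ := by
  have := hS.epi_g
  exact 𝒜.prop_of_iso
    (IsColimit.coconePointUniqueUpToIso hS.exact.gIsCokernel (colimit.isColimit _)).symm h.2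

/-- A monomorphism with cokernel `A` has the left lifting property with respect to an epimorphism
with kernel `B` if all extensions of `A` by `B` split. -/
lemma hasLiftingProperty_of_extensionsSplit {U V E F : C} (i : U ⟶ V) (p : E ⟶ F) [Mono i] [Epi p]
    (h : ExtensionsSplit (cokernel i) (kernel p)) : HasLiftingProperty i p := by
  refine ⟨fun {f g} sq => ?_⟩
  -- A lift is a section of q : E ×_F V → V that restricts to a on U. Dividing E ×_F V by the image
  -- of a leaves an extension of `cokernel i` by `kernel p`, which splits.
  have hE := shortExact_pullback (shortExact_kernel p) g
  set q : pullback p g ⟶ V := pullback.snd p g with hq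
  set k : kernel p ⟶ pullback p g := pullback.lift (kernel.ι p) 0 (by simp) with hk
  have hkq : k ≫ q = 0 := pullback.lift_snd _ _ _
  have hE' : (ShortComplex.mk k q hkq).ShortExact := hE
  have : Mono k := hE'.mono_f
  have : Epi q := hE'.epi_g
  let a : U ⟶ pullback p g := pullback.lift f i sq.w
  have haq : a ≫ q = i := pullback.lift_snd _ _ _
  have : Mono a := by
    have : Mono (a ≫ q) := by rwa [haq]
    exact mono_of_mono a q
  let π := cokernel.π a
  let t : cokernel a ⟶ cokernel i := cokernel.desc a (q ≫ cokernel.π i) (by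
    rw [reassoc_of% haq, cokernel.condition])
  have hπt : π ≫ t = q ≫ cokernel.π i := cokernel.π_desc _ _ _
  have : Epi t := by
    have : Epi (π ≫ t) := by rw [hπt]; infer_instance
    exact epi_of_epi π t
  have hw : (k ≫ π) ≫ t = 0 := by rw [Category.assoc, hπt, reassoc_of% hkq, zero_comp]
  have hmono : Mono (k ≫ π) := by
    refine Preadditive.mono_of_cancel_zero _ fun {T} x hx => ?_
    have ha := shortExact_cokernel a
    have hx' : (x ≫ k) ≫ cokernel.π a = 0 := by rw [Category.assoc]; exact hx
    have hl := ha.exact.lift_f (x ≫ k) hx'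
    set y := ha.exact.lift (x ≫ k) hx'
    have hy : y ≫ i = 0 := by
      rw [← haq, ← Category.assoc, show y ≫ a = x ≫ k from hl, Category.assoc, hkq, comp_zero]
    have hy0 : y = 0 := (cancel_mono i).1 (hy.trans zero_comp.symm)
    rw [hy0, zero_comp] at hl
    exact (cancel_mono k).1 (hl.symm.trans zero_comp.symm)
  have hS : (ShortComplex.mk (k ≫ π) t hw).ShortExact := by
    refine ⟨ShortComplex.exact_of_g_is_cokernel _ ?_⟩
    refine CokernelCofork.IsColimit.ofπ' _ _ fun {T} m hm => ?_
    dsimp at m hm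
    have hm' : k ≫ (π ≫ m) = 0 := by rw [← Category.assoc]; exact hm
    have hd : q ≫ hE'.exact.desc (π ≫ m) hm' = π ≫ m := hE'.exact.g_desc _ hm'
    refine ⟨cokernel.desc i (hE'.exact.desc (π ≫ m) hm') ?_, ?_⟩
    · rw [← haq, Category.assoc, hd, ← Category.assoc, cokernel.condition, zero_comp]
    · rw [← cancel_epi π]
      dsimp
      rw [reassoc_of% hπt, cokernel.π_desc, hd]
  obtain ⟨r, hr⟩ := h _ _ _ _ hS
  -- The endomorphism 1 - πrk kills k, so it descends along q to a section s; as aπ = 0, it fixes a,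
  -- which gives is = a.
  have hs₀ : k ≫ (𝟙 _ - π ≫ r ≫ k) = 0 := by
    rw [Preadditive.comp_sub, Category.comp_id, ← Category.assoc k, ← Category.assoc (k ≫ π), hr,
      Category.id_comp, sub_self]
  have hs : q ≫ hE'.exact.desc _ hs₀ = 𝟙 _ - π ≫ r ≫ k := hE'.exact.g_desc _ hs₀
  set s : V ⟶ pullback p g := hE'.exact.desc _ hs₀
  have hsq : s ≫ q = 𝟙 V := by
    rw [← cancel_epi q, reassoc_of% hs, Preadditive.sub_comp]
    simp [hkq]
  have his : i ≫ s = a := by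
    rw [← haq, Category.assoc, hs, Preadditive.comp_sub, Category.comp_id, ← Category.assoc a,
      show a ≫ π = 0 from cokernel.condition a, zero_comp, sub_zero]
  refine ⟨⟨⟨s ≫ pullback.fst p g, ?_, ?_⟩⟩⟩
  · rw [← Category.assoc, his]
    exact pullback.lift_fst _ _ _
  · rw [Category.assoc, pullback.condition, ← Category.assoc, hsq, Category.id_comp]

lemma extensionsSplit_congr_left {A A' B : C} (e : A ≅ A') (h : ExtensionsSplit A B) :
    ExtensionsSplit A' B := by
  intro E i p w hS
  refine h E i (p ≫ e.inv) (by rw [reassoc_of% w, zero_comp]) (ShortComplex.shortExact_of_iso ?_ hS)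
  exact ShortComplex.isoMk (Iso.refl _) (Iso.refl _) e.symm

lemma extensionsSplit_congr_right {A B B' : C} (e : B ≅ B') (h : ExtensionsSplit A B) :
    ExtensionsSplit A B' :=
  (extensionsSplit_congr_left e.symm.op h.op).unop

namespace HereditaryPair

variable {𝒜 ℬ : ObjectProperty C} (h : HereditaryPair 𝒜 ℬ)

include h

lemma isClosedUnderIsomorphisms_left : 𝒜.IsClosedUnderIsomorphisms where
  of_iso e hX := (h.left_iff _).2 fun B hB =>
    extensionsSplit_congr_left e ((h.left_iff _).1 hX B hB)

lemma isClosedUnderIsomorphisms_right : ℬ.IsClosedUnderIsomorphisms where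
  of_iso e hX := (h.right_iff _).2 fun A hA =>
    extensionsSplit_congr_right e ((h.right_iff _).1 hX A hA)

lemma hasLiftingProperty {U V E F : C} {i : U ⟶ V} {p : E ⟶ F} (hi : monoWithCokernel 𝒜 i)
    (hp : epiWithKernel ℬ p) : HasLiftingProperty i p := by
  have := hi.1
  have := hp.1
  exact hasLiftingProperty_of_extensionsSplit i p ((h.left_iff _).1 hi.2 _ hp.2)

lemma left_of_llp {A : C} (hA : (epiWithKernel ℬ).llp (0 : 0 ⟶ A)) : 𝒜 A := by
  have := h.isClosedUnderIsomorphisms_right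
  refine (h.left_iff A).2 fun B hB => extensionsSplit_of_exists_section fun E i p w hS => ?_
  have := hA p (epiWithKernel_of_shortExact hS hB)
  have sq : CommSq (0 : 0 ⟶ E) (0 : 0 ⟶ A) p (𝟙 A) := ⟨by simp⟩
  exact ⟨sq.lift, sq.fac_right⟩

lemma right_of_rlp {B : C} (hB : (monoWithCokernel 𝒜).rlp (0 : B ⟶ 0)) : ℬ B := by
  have := h.isClosedUnderIsomorphisms_left
  refine (h.right_iff B).2 fun A hA E i p w hS => ?_
  have := hB i (monoWithCokernel_of_shortExact hS hA)
  have sq : CommSq (𝟙 B) i (0 : B ⟶ 0) (0 : E ⟶ 0) := ⟨by simp⟩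
  exact ⟨sq.lift, sq.fac_left⟩

/-- An embedding of U into an object B of ℬ extends along f, since B → 0 is in the right class; so f
is monic. Lifts from the cokernel of f are lifts from its target that vanish on U. -/
lemma llp_eq : (epiWithKernel ℬ).llp = monoWithCokernel 𝒜 := by
  have := h.isClosedUnderIsomorphisms_right
  ext U V f
  refine ⟨fun hf => ⟨?_, h.left_of_llp ?_⟩, fun hf _ _ p hp => h.hasLiftingProperty hf hp⟩
  · obtain ⟨B, A, i, p, w, hA, hB, hS⟩ := h.preenvelope U
    have hB' : epiWithKernel ℬ (0 : B ⟶ 0) :=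
      ⟨inferInstance, ℬ.prop_of_iso kernelZeroIsoSource.symm hB⟩
    have := hf _ hB'
    have sq : CommSq i f (0 : B ⟶ 0) 0 := ⟨by simp⟩
    have := hS.mono_f
    have : Mono (f ≫ sq.lift) := by rwa [sq.fac_left]
    exact mono_of_mono f sq.lift
  · intro X Y p hp
    refine ⟨fun {a b} sq => ⟨⟨?_⟩⟩⟩
    have := hf p hp
    have sq' : CommSq (0 : U ⟶ X) f p (cokernel.π f ≫ b) := ⟨by simp⟩
    refine ⟨cokernel.desc f sq'.lift sq'.fac_left, Subsingleton.elim _ _, ?_⟩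
    rw [← cancel_epi (cokernel.π f), cokernel.π_desc_assoc, sq'.fac_right]

lemma rlp_eq : (monoWithCokernel 𝒜).rlp = epiWithKernel ℬ := by
  have := h.isClosedUnderIsomorphisms_left
  ext E F f
  refine ⟨fun hf => ⟨?_, h.right_of_rlp ?_⟩, fun hf _ _ p hp => h.hasLiftingProperty hp hf⟩
  · obtain ⟨B, A, i, p, w, hA, hB, hS⟩ := h.precover F
    have hA' : monoWithCokernel 𝒜 (0 : 0 ⟶ A) :=
      ⟨inferInstance, 𝒜.prop_of_iso cokernelZeroIsoTarget.symm hA⟩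
    have := hf _ hA'
    have sq : CommSq 0 (0 : 0 ⟶ A) f p := ⟨by simp⟩
    have := hS.epi_g
    have : Epi (sq.lift ≫ f) := by rwa [sq.fac_right]
    exact epi_of_epi sq.lift f
  · intro X Y p hp
    refine ⟨fun {a b} sq => ⟨⟨?_⟩⟩⟩
    have := hf p hp
    have sq' : CommSq (a ≫ kernel.ι f) p f 0 := ⟨by simp⟩
    refine ⟨kernel.lift f sq'.lift sq'.fac_right, ?_, Subsingleton.elim _ _⟩
    rw [← cancel_mono (kernel.ι f), Category.assoc, kernel.lift_ι, sq'.fac_left]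

lemma right_iff_epiWithKernel {B : C} : ℬ B ↔ epiWithKernel ℬ (0 : B ⟶ 0) := by
  have := h.isClosedUnderIsomorphisms_right
  exact ⟨fun hB => ⟨inferInstance, ℬ.prop_of_iso kernelZeroIsoSource.symm hB⟩,
    fun hB => ℬ.prop_of_iso kernelZeroIsoSource hB.2⟩

/-- Immediate once the class is described by a lifting property. -/
lemma monoWithCokernel_comp {X Y Z : C} {f : X ⟶ Y} {g : Y ⟶ Z} (hf : monoWithCokernel 𝒜 f)
    (hg : monoWithCokernel 𝒜 g) : monoWithCokernel 𝒜 (f ≫ g) := by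
  rw [← h.llp_eq] at hf hg ⊢
  exact MorphismProperty.comp_mem _ _ _ hf hg

lemma monoWithCokernel_id (X : C) : monoWithCokernel 𝒜 (𝟙 X) := by
  rw [← h.llp_eq]
  exact MorphismProperty.id_mem _ _

/-- Every morphism factors as a monomorphism with cokernel in `𝒜` followed by an epimorphism with
kernel in `ℬ`. -/
lemma exists_factorization {M N : C} (f : M ⟶ N) :
    ∃ (Z : C) (i : M ⟶ Z) (p : Z ⟶ N), monoWithCokernel 𝒜 i ∧ epiWithKernel ℬ p ∧ i ≫ p = f := by
  have := h.isClosedUnderIsomorphisms_left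
  have := h.isClosedUnderIsomorphisms_right
  -- Adding a precover N' of N to M makes the morphism epic; pushing out along an embedding of its
  -- kernel into an object of ℬ then corrects the kernel. Both steps enlarge the source by a
  -- quotient in 𝒜.
  obtain ⟨B₀, N', i₀, n, w₀, hN', hB₀, hS₀⟩ := h.precover N
  have := hS₀.epi_g
  let t : M ⊞ N' ⟶ N := biprod.desc f n
  have : Epi t := by
    have : Epi (biprod.inr ≫ t) := by rwa [biprod.inr_desc]
    exact epi_of_epi biprod.inr t
  obtain ⟨B, A, j, q, w, hA, hB, hS⟩ := h.preenvelope (kernel t)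
  have e₁ := shortExact_pushout (shortExact_kernel t) j
  have e₂ := shortExact_pushout hS (kernel.ι t)
  have hinl : monoWithCokernel 𝒜 (biprod.inl : M ⟶ M ⊞ N') := by
    refine monoWithCokernel_of_shortExact (S := ShortComplex.mk biprod.inl biprod.snd (by simp))
      ⟨ShortComplex.exact_of_g_is_cokernel _ (biprod.isCokernelInlCokernelFork _ _)⟩ hN'
  have hinr : monoWithCokernel 𝒜 (pushout.inl (kernel.ι t) j) := by
    rw [← inr_comp_pushoutSymmetry_hom]
    refine h.monoWithCokernel_comp (monoWithCokernel_of_shortExact e₂ hA) ?_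
    rw [← h.llp_eq]
    exact MorphismProperty.llp_of_isIso _ _
  refine ⟨_, biprod.inl ≫ pushout.inl _ _, _, h.monoWithCokernel_comp hinl hinr,
    epiWithKernel_of_shortExact e₁ hB, ?_⟩
  rw [Category.assoc]
  exact (congrArg _ (pushout.inl_desc _ _ _)).trans (biprod.inl_desc f n)

end HereditaryPair

end HereditaryPair

/-! ### The path category of the infinite line -/

section Line

/-- The vertex `i` of the infinite line, as an object of the path category. -/
abbrev vtx (i : ℤ) : Paths InfiniteLine := (Paths.of InfiniteLine).obj i

/-- The arrow `i ⟶ j` of the infinite line, for `i = j + 1`. -/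
def arrow {i j : ℤ} (h : i = j + 1) : vtx i ⟶ vtx j :=
  (Paths.of InfiniteLine).map (X := i) (Y := j) (PLift.up h)

/-- The arrow `j + 1 ⟶ j` of the infinite line. -/
abbrev step (j : ℤ) : vtx (j + 1) ⟶ vtx j := arrow rfl

/-- The integer underlying a vertex. -/
def toInt (x : InfiniteLine) : ℤ := x

lemma toInt_of_hom {x y : InfiniteLine} (a : x ⟶ y) : toInt x = toInt y + 1 := a.down

lemma toInt_le_of_path {x y : InfiniteLine} (p : Quiver.Path x y) : toInt y ≤ toInt x := by
  induction p with
  | nil => exact le_rfl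
  | cons p a ih => have := toInt_of_hom a; omega

/-- Each arrow lowers the integer by one and is determined by its target, so a path is determined by
its ends. Later comparisons of composite paths rest on this. -/
instance (x y : Paths InfiniteLine) : Subsingleton (x ⟶ y) := by
  refine ⟨fun p q => ?_⟩
  change Quiver.Path (V := InfiniteLine) x y at p q
  induction p with
  | nil =>
    cases q with
    | nil => rfl
    | cons q a =>
      have h := toInt_of_hom a
      have := toInt_le_of_path q
      omega
  | cons p a ih =>
    have h := toInt_of_hom a
    cases q with
    | nil =>
      have := toInt_le_of_path p
      omega
    | cons q a' =>
      rename_i b _ b'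
      have hb : @Eq (Paths InfiniteLine) b b' := h.trans (toInt_of_hom a').symm
      subst hb
      rw [ih q]
      exact congrArg _ (Subsingleton.elim (α := PLift _) a a')

/-- The path `i ⟶ j` of the infinite line, for `j ≤ i`. -/
lemma nonempty_path {i j : ℤ} (h : j ≤ i) : Nonempty (vtx i ⟶ vtx j) := by
  obtain ⟨n, rfl⟩ : ∃ n : ℕ, i = j + n := ⟨(i - j).toNat, by omega⟩
  clear h
  induction n with
  | zero => exact ⟨eqToHom (by simp)⟩
  | succ n ih =>
    obtain ⟨p⟩ := ih
    exact ⟨arrow (by push_cast; ring) ≫ p⟩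

/-- The path `i ⟶ j` of the infinite line, for `j ≤ i`. -/
def path {i j : ℤ} (h : j ≤ i) : vtx i ⟶ vtx j := (nonempty_path h).some

end Line

/-! ### Representations of the line, and Φ and Ψ in terms of single maps -/

section Representations

variable {C : Type u} [Category.{v} C]

/-- The representation of the infinite line with given objects and maps. -/
def mkRep (M : ℤ → C) (d : ∀ j, M (j + 1) ⟶ M j) : QuiverRep InfiniteLine C :=
  Paths.lift
    { obj := fun i : ℤ => M i
      map := fun {_ j : ℤ} a => eqToHom (congrArg M a.down) ≫ d j }

lemma mkRep_map_step (M : ℤ → C) (d : ∀ j, M (j + 1) ⟶ M j) (j : ℤ) :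
    (mkRep M d).map (step j) = d j := by
  refine (Paths.lift_toPath _ _).trans ?_
  exact Category.id_comp _

/-- A morphism of representations of the infinite line from its components. -/
def mkHom {X Y : QuiverRep InfiniteLine C} (f : ∀ i : ℤ, X.obj (vtx i) ⟶ Y.obj (vtx i))
    (comm : ∀ j, X.map (step j) ≫ f j = f (j + 1) ≫ Y.map (step j)) : X ⟶ Y :=
  Paths.liftNatTrans (fun i => f (toInt i)) fun {i j} a => by
    have h : ∀ {i j : ℤ} (h : i = j + 1), X.map (arrow h) ≫ f j = f i ≫ Y.map (arrow h) := by
      rintro _ j rfl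
      exact comm j
    exact h (toInt_of_hom a)

@[simp]
lemma mkHom_app {X Y : QuiverRep InfiniteLine C} (f : ∀ i : ℤ, X.obj (vtx i) ⟶ Y.obj (vtx i))
    (comm : ∀ j, X.map (step j) ≫ f j = f (j + 1) ≫ Y.map (step j)) (i : ℤ) :
    (mkHom f comm).app (vtx i) = f i := rfl

lemma repHom_ext {X Y : QuiverRep InfiniteLine C} {f g : X ⟶ Y}
    (h : ∀ i : ℤ, f.app (vtx i) = g.app (vtx i)) : f = g :=
  NatTrans.ext (funext h)

/-- There is exactly one arrow into each vertex. -/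
abbrev uniqueCostar (j : InfiniteLine) : Unique (Quiver.Costar j) where
  default := ⟨(toInt j + 1 : ℤ), ⟨rfl⟩⟩
  uniq := by
    rintro ⟨i, ⟨h⟩⟩
    subst h
    rfl

/-- There is exactly one arrow out of each vertex. -/
abbrev uniqueStar (i : InfiniteLine) : Unique (Quiver.Star i) where
  default := ⟨(toInt i - 1 : ℤ), ⟨(Int.sub_add_cancel (toInt i) 1).symm⟩⟩
  uniq := by
    rintro ⟨j, a⟩
    have h := toInt_of_hom a
    obtain rfl : j = (toInt i - 1 : ℤ) := by change toInt j = _; omega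
    rfl

variable [Abelian C]

/-- A coproduct over one arrow is its only summand, so φ is the structure map up to isomorphism. -/
lemma phi_at_iff_of_unique {Q : Type u'} [Quiver.{v'} Q]
    [∀ i : Q, HasCoproductsOfShape (Quiver.Costar i) C]
    {𝒜 : ObjectProperty C} [𝒜.IsClosedUnderIsomorphisms] (X : QuiverRep Q C) (j : Q)
    [Unique (Quiver.Costar j)] :
    Mono (phi X j) ∧ 𝒜 (cokernel (phi X j)) ↔
      monoWithCokernel 𝒜 (arrowMap X (default : Quiver.Costar j).2) := by
  let e := coproductUniqueIso fun a : Quiver.Costar j => vertexObj X a.1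
  have h : arrowMap X (default : Quiver.Costar j).2 = e.inv ≫ phi X j := by
    rw [coproductUniqueIso_inv]
    exact (Sigma.ι_desc (fun a : Quiver.Costar j => arrowMap X a.2) default).symm
  rw [h]
  refine and_congr ⟨fun _ => mono_comp _ _, fun hm => ?_⟩
    (𝒜.prop_iff_of_iso (cokernelEpiComp _ _)).symm
  have := mono_comp e.hom (e.inv ≫ phi X j)
  rwa [Iso.hom_inv_id_assoc] at this

lemma psi_at_iff_of_unique {Q : Type u'} [Quiver.{v'} Q]
    [∀ i : Q, HasProductsOfShape (Quiver.Star i) C]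
    {ℬ : ObjectProperty C} [ℬ.IsClosedUnderIsomorphisms] (X : QuiverRep Q C) (i : Q)
    [Unique (Quiver.Star i)] :
    Epi (psi X i) ∧ ℬ (kernel (psi X i)) ↔
      epiWithKernel ℬ (arrowMap X (default : Quiver.Star i).2) := by
  let e := productUniqueIso fun a : Quiver.Star i => vertexObj X a.1
  have h : arrowMap X (default : Quiver.Star i).2 = psi X i ≫ e.hom := by
    rw [productUniqueIso_hom]
    exact (Pi.lift_π (fun a : Quiver.Star i => arrowMap X a.2) default).symm
  rw [h]
  refine and_congr ⟨fun _ => epi_comp _ _, fun hm => ?_⟩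
    (ℬ.prop_iff_of_iso (kernelCompMono _ _)).symm
  have := epi_comp (psi X i ≫ e.hom) e.inv
  rwa [Category.assoc, Iso.hom_inv_id, Category.comp_id] at this

lemma phi_iff_monoWithCokernel [∀ i : InfiniteLine, HasCoproductsOfShape (Quiver.Costar i) C]
    {𝒜 : ObjectProperty C} [𝒜.IsClosedUnderIsomorphisms] {X : QuiverRep InfiniteLine C} :
    Phi 𝒜 X ↔ ∀ j : ℤ, monoWithCokernel 𝒜 (X.map (step j)) :=
  forall_congr' fun j =>
    let := uniqueCostar j
    phi_at_iff_of_unique X j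

lemma psi_iff_epiWithKernel [∀ i : InfiniteLine, HasProductsOfShape (Quiver.Star i) C]
    {ℬ : ObjectProperty C} [ℬ.IsClosedUnderIsomorphisms] {X : QuiverRep InfiniteLine C} :
    Psi ℬ X ↔ ∀ j : ℤ, epiWithKernel ℬ (X.map (step j)) := by
  -- ψ is indexed by the source of the arrow and `step` by its target; keeping the relation i = j +
  -- 1 as a hypothesis avoids transport along i - 1 + 1 = i.
  have h : ∀ {i : InfiniteLine} {j : ℤ} (h : toInt i = j + 1),
      (Epi (psi X i) ∧ ℬ (kernel (psi X i)) ↔ epiWithKernel ℬ (X.map (arrow h))) := by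
    intro i j h
    obtain rfl : j = toInt i - 1 := by omega
    let := uniqueStar i
    exact psi_at_iff_of_unique X i
  refine ⟨fun hX j => (h rfl).1 (hX (j + 1 : ℤ)), fun hX i => ?_⟩
  obtain ⟨j, hj⟩ : ∃ j, toInt i = j + 1 := ⟨toInt i - 1, by omega⟩
  have e : ∀ {k : ℤ} (h : k = j + 1), epiWithKernel ℬ (X.map (arrow h)) := by
    rintro _ rfl
    exact hX j
  exact (h hj).2 (e hj)

end Representations

/-! ### Extending lifts down the line -/

section Lifting

variable {C : Type u} [Category.{v} C] [Abelian C] {𝒜 ℬ : ObjectProperty C}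

/-- For a morphism of short exact sequences whose last component is a monomorphism with cokernel
in `𝒜`, the comparison map out of the pushout of the left square is one as well. -/
lemma HereditaryPair.monoWithCokernel_pushoutDesc (h : HereditaryPair 𝒜 ℬ) {S₁ S₂ : ShortComplex C}
    (hS₁ : S₁.ShortExact) (hS₂ : S₂.ShortExact) (φ : S₁ ⟶ S₂) (hφ : monoWithCokernel 𝒜 φ.τ₃) :
    monoWithCokernel 𝒜 (pushout.desc φ.τ₂ S₂.f φ.comm₁₂.symm) := by
  have := h.isClosedUnderIsomorphisms_left
  set m := pushout.desc φ.τ₂ S₂.f φ.comm₁₂.symm with hm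
  have e := shortExact_pushout hS₁ φ.τ₁
  let ψ : ShortComplex.mk (pushout.inr S₁.f φ.τ₁)
      (pushout.desc S₁.g 0 (S₁.zero.trans comp_zero.symm : S₁.f ≫ S₁.g = φ.τ₁ ≫ 0))
      (pushout.inr_desc _ _ _) ⟶ S₂ :=
    { τ₁ := 𝟙 _
      τ₂ := m
      τ₃ := φ.τ₃
      comm₁₂ := (Category.id_comp _).trans (pushout.inr_desc _ _ _).symm
      comm₂₃ := by
        apply pushout.hom_ext
        · dsimp
          rw [pushout.inl_desc_assoc, pushout.inl_desc_assoc, φ.comm₂₃]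
        · dsimp
          rw [pushout.inr_desc_assoc, pushout.inr_desc_assoc, S₂.zero, zero_comp] }
  have := hS₁.epi_g
  have := hS₂.epi_g
  have := hS₂.mono_f
  have := hφ.1
  have : Mono m := by
    have : Mono ψ.τ₁ := inferInstanceAs (Mono (𝟙 _))
    have := e.mono_f
    have : Mono ψ.τ₃ := hφ.1
    exact ShortComplex.mono_τ₂_of_exact_of_mono ψ e.exact
  -- The comparison map has the same cokernel as φ.τ₃.
  have hw : m ≫ S₂.g ≫ cokernel.π φ.τ₃ = 0 := by
    apply pushout.hom_ext
    · rw [pushout.inl_desc_assoc, φ.comm₂₃_assoc, cokernel.condition]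
      simp
    · rw [pushout.inr_desc_assoc, S₂.zero_assoc]
      simp
  refine monoWithCokernel_of_shortExact (S := ShortComplex.mk m (S₂.g ≫ cokernel.π φ.τ₃) hw)
    ⟨ShortComplex.exact_of_g_is_cokernel _ ?_⟩ hφ.2
  refine CokernelCofork.IsColimit.ofπ' _ _ fun {T} k hk => ?_
  dsimp at k hk
  have h₁ : φ.τ₂ ≫ k = 0 := by
    rw [← pushout.inl_desc φ.τ₂ S₂.f φ.comm₁₂.symm, Category.assoc, hk, comp_zero]
  have h₂ : S₂.f ≫ k = 0 := by
    rw [← pushout.inr_desc φ.τ₂ S₂.f φ.comm₁₂.symm, Category.assoc, hk, comp_zero]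
  have hd := hS₂.exact.g_desc k h₂
  refine ⟨cokernel.desc _ (hS₂.exact.desc k h₂) ?_, ?_⟩
  · rw [← cancel_epi S₁.g, ← φ.comm₂₃_assoc, hd, h₁, comp_zero]
  · dsimp
    rw [Category.assoc, cokernel.π_desc, hd]

/-- Extension of partial lifts along a morphism of short exact sequences. -/
lemma HereditaryPair.exists_relative_lift (h : HereditaryPair 𝒜 ℬ) {S₁ S₂ : ShortComplex C}
    (hS₁ : S₁.ShortExact) (hS₂ : S₂.ShortExact) (φ : S₁ ⟶ S₂) (hφ : monoWithCokernel 𝒜 φ.τ₃)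
    {E F : C} (p : E ⟶ F) (hp : epiWithKernel ℬ p) (a : S₁.X₂ ⟶ E) (b : S₂.X₁ ⟶ E)
    (hab : S₁.f ≫ a = φ.τ₁ ≫ b) (v : S₂.X₂ ⟶ F) (hav : a ≫ p = φ.τ₂ ≫ v)
    (hbv : b ≫ p = S₂.f ≫ v) :
    ∃ s : S₂.X₂ ⟶ E, S₂.f ≫ s = b ∧ φ.τ₂ ≫ s = a ∧ s ≫ p = v := by
  have := h.hasLiftingProperty (h.monoWithCokernel_pushoutDesc hS₁ hS₂ φ hφ) hp
  have sq : CommSq (pushout.desc a b hab) (pushout.desc φ.τ₂ S₂.f φ.comm₁₂.symm) p v := by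
    refine ⟨pushout.hom_ext ?_ ?_⟩
    · rw [pushout.inl_desc_assoc, pushout.inl_desc_assoc, hav]
    · rw [pushout.inr_desc_assoc, pushout.inr_desc_assoc, hbv]
  refine ⟨sq.lift, ?_, ?_, sq.fac_right⟩
  · have := pushout.inr_desc_assoc φ.τ₂ S₂.f φ.comm₁₂.symm sq.lift
    rwa [sq.fac_left, pushout.inr_desc, eq_comm] at this
  · have := pushout.inl_desc_assoc φ.τ₂ S₂.f φ.comm₁₂.symm sq.lift
    rwa [sq.fac_left, pushout.inl_desc, eq_comm] at this

/-- The representations of the line all of whose maps are monomorphisms with cokernel in `𝒜`. -/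
def filteredRep (𝒜 : ObjectProperty C) : ObjectProperty (QuiverRep InfiniteLine C) :=
  fun X => ∀ j : ℤ, monoWithCokernel 𝒜 (X.map (step j))

section Evaluation

variable {J : Type u'} [Category.{v'} J] {U V : J ⥤ C} (f : U ⟶ V)

/-- The short complex `U(x) → V(x) → (Coker f)(x)`. -/
abbrev levelComplex (x : J) : ShortComplex C :=
  ShortComplex.mk (f.app x) ((cokernel.π f).app x) (by
    rw [← NatTrans.comp_app, cokernel.condition, zero_app])

lemma levelComplex_shortExact [Mono f] (x : J) : (levelComplex f x).ShortExact :=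
  (shortExact_cokernel f).map_of_exact ((evaluation J C).obj x)

/-- The morphism of short complexes induced by a morphism of the index category. -/
def levelMap {x y : J} (a : x ⟶ y) : levelComplex f x ⟶ levelComplex f y where
  τ₁ := U.map a
  τ₂ := V.map a
  τ₃ := (cokernel f).map a
  comm₁₂ := f.naturality a
  comm₂₃ := (cokernel.π f).naturality a

lemma HereditaryPair.exists_relative_lift_app (h : HereditaryPair 𝒜 ℬ) [Mono f] {x y : J}
    (α : x ⟶ y) (hα : monoWithCokernel 𝒜 ((cokernel f).map α)) {E F : C} (p : E ⟶ F)
    (hp : epiWithKernel ℬ p) (a : V.obj x ⟶ E) (b : U.obj y ⟶ E)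
    (hab : f.app x ≫ a = U.map α ≫ b) (v : V.obj y ⟶ F) (hav : a ≫ p = V.map α ≫ v)
    (hbv : b ≫ p = f.app y ≫ v) :
    ∃ s : V.obj y ⟶ E, f.app y ≫ s = b ∧ V.map α ≫ s = a ∧ s ≫ p = v :=
  h.exists_relative_lift (levelComplex_shortExact f x) (levelComplex_shortExact f y)
    (levelMap f α) hα p hp a b hab v hav hbv

end Evaluation

lemma exists_seq {α : ℕ → Type*} (r : ∀ n, α n → α (n + 1) → Prop) (a : α 0)
    (hr : ∀ n a, ∃ b, r n a b) : ∃ s : ∀ n, α n, s 0 = a ∧ ∀ n, r n (s n) (s (n + 1)) := by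
  choose F hF using hr
  exact ⟨fun n => Nat.rec a (fun n b => F n b) n, rfl, fun n => hF n _⟩

/-- Partial solutions, at the vertices `j ≥ k`, of a lifting problem of representations. -/
structure PartialLift {U V E F : QuiverRep InfiniteLine C} (f : U ⟶ V) (p : E ⟶ F) (a : U ⟶ E)
    (b : V ⟶ F) (k : ℤ) where
  app : ∀ j : ℤ, k ≤ j → (V.obj (vtx j) ⟶ E.obj (vtx j))
  fac_left : ∀ j hj, f.app (vtx j) ≫ app j hj = a.app (vtx j)
  fac_right : ∀ j hj, app j hj ≫ p.app (vtx j) = b.app (vtx j)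
  comm : ∀ (j : ℤ) (hj : k ≤ j),
    V.map (step j) ≫ app j hj = app (j + 1) (by omega) ≫ E.map (step j)

/-- At vertex m the lift is prescribed on U(m) by a and on V(m+1) by the lift one vertex above. The
relative lifting lemma applies because (coker f)(m+1) → (coker f)(m) is a monomorphism with cokernel
in 𝒜. -/
lemma HereditaryPair.exists_partialLift_extension (h : HereditaryPair 𝒜 ℬ)
    {U V E F : QuiverRep InfiniteLine C} {f : U ⟶ V} {p : E ⟶ F} {a : U ⟶ E} {b : V ⟶ F}
    (hf : monoWithCokernel (filteredRep 𝒜) f) (sq : CommSq a f p b) {k m : ℤ} (hk : k = m + 1)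
    (hp : epiWithKernel ℬ (p.app (vtx m))) (s : PartialLift f p a b k) :
    ∃ t : PartialLift f p a b m, ∀ j hj hj', t.app j hj' = s.app j hj := by
  subst hk
  have := hf.1
  have hw : ∀ j, f.app (vtx j) ≫ b.app (vtx j) = a.app (vtx j) ≫ p.app (vtx j) := fun j => by
    rw [← NatTrans.comp_app, ← sq.w, NatTrans.comp_app]
  obtain ⟨t, ht₁, ht₂, ht₃⟩ := h.exists_relative_lift_app f (step m) (hf.2 m) (p.app (vtx m)) hp
    (s.app (m + 1) le_rfl ≫ E.map (step m)) (a.app (vtx m))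
    (by rw [reassoc_of% (s.fac_left (m + 1) le_rfl), a.naturality]) (b.app (vtx m))
    (by rw [Category.assoc, p.naturality, reassoc_of% (s.fac_right (m + 1) le_rfl), b.naturality])
    (hw m).symm
  have key : ∀ j : ℤ, ¬ m + 1 ≤ j → m ≤ j → j = m := fun j _ _ => by omega
  let T : ∀ j : ℤ, m ≤ j → (V.obj (vtx j) ⟶ E.obj (vtx j)) := fun j hj =>
    if h : m + 1 ≤ j then s.app j h else
      eqToHom (by rw [key j h hj]) ≫ t ≫ eqToHom (by rw [key j h hj])
  have hT : ∀ j hj hj', T j hj' = s.app j hj := fun j hj hj' => dif_pos hj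
  have hTm : T m le_rfl = t := by
    simp [T]
  refine ⟨⟨T, fun j hj => ?_, fun j hj => ?_, fun j hj => ?_⟩, hT⟩
  · by_cases hj' : m + 1 ≤ j
    · rw [hT j hj' hj, s.fac_left]
    · obtain rfl := key j hj' hj
      rw [hTm, ht₁]
  · by_cases hj' : m + 1 ≤ j
    · rw [hT j hj' hj, s.fac_right]
    · obtain rfl := key j hj' hj
      rw [hTm, ht₃]
  · rw [hT (j + 1) (by omega) (by omega)]
    by_cases hj' : m + 1 ≤ j
    · rw [hT j hj' hj, s.comm]
    · obtain rfl := key j hj' hj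
      rw [hTm, ht₂]

/-- A partial solution of a lifting problem against a monomorphism with filtered cokernel extends
to all vertices if the remaining components of the right map are epimorphisms with kernel in `ℬ`. -/
lemma HereditaryPair.exists_lift_of_partialLift (h : HereditaryPair 𝒜 ℬ)
    {U V E F : QuiverRep InfiniteLine C} {f : U ⟶ V} {p : E ⟶ F} {a : U ⟶ E} {b : V ⟶ F}
    (hf : monoWithCokernel (filteredRep 𝒜) f) (sq : CommSq a f p b) (k : ℤ)
    (hp : ∀ j : ℤ, j < k → epiWithKernel ℬ (p.app (vtx j))) (s : PartialLift f p a b k) :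
    ∃ l : V ⟶ E, f ≫ l = a ∧ l ≫ p = b ∧ ∀ j hj, l.app (vtx j) = s.app j hj := by
  let e : PartialLift f p a b (k - (0 : ℕ)) :=
    ⟨fun j hj => s.app j (by omega), fun j hj => s.fac_left j _, fun j hj => s.fac_right j _,
      fun j hj => s.comm j _⟩
  obtain ⟨t, ht₀, ht⟩ := exists_seq (α := fun n => PartialLift f p a b (k - (n : ℕ)))
    (fun n x y => ∀ j hj hj', y.app j hj' = x.app j hj) e
    (fun n x => h.exists_partialLift_extension hf sq (by push_cast; ring)
      (hp _ (by omega)) x)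
  have hmono : ∀ (n d : ℕ) (j : ℤ) (hj : k - (n : ℕ) ≤ j) (hj' : k - ((n + d : ℕ) : ℕ) ≤ j),
      (t (n + d)).app j hj' = (t n).app j hj := by
    intro n d
    induction d with
    | zero => intro j hj hj'; rfl
    | succ d ih => intro j hj hj'; exact (ht (n + d) j (by push_cast; omega) hj').trans (ih j hj _)
  have hle : ∀ (n m : ℕ) (j : ℤ) (hj : k - (n : ℕ) ≤ j) (hj' : k - (m : ℕ) ≤ j),
      (t m).app j hj' = (t n).app j hj := by
    intro n m j hj hj'
    rcases le_total n m with hnm | hnm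
    · obtain ⟨d, rfl⟩ := Nat.exists_eq_add_of_le hnm
      exact hmono n d j hj hj'
    · obtain ⟨d, rfl⟩ := Nat.exists_eq_add_of_le hnm
      exact (hmono m d j hj' hj).symm
  -- Stage n covers the vertices j ≥ k - n, so this is the first stage that covers j.
  let n : ℤ → ℕ := fun j => (k - j).toNat
  have hn : ∀ j, k - (n j : ℕ) ≤ j := fun j => by simp only [n]; omega
  refine ⟨mkHom (fun j => (t (n j)).app j (hn j)) fun j => ?_, repHom_ext fun j => ?_,
    repHom_ext fun j => ?_, fun j hj => ?_⟩
  · rw [hle (n j) (n (j + 1)) (j + 1) (by have := hn j; omega) (hn _)]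
    exact (t (n j)).comm j (hn j)
  · exact (t (n j)).fac_left j (hn j)
  · exact (t (n j)).fac_right j (hn j)
  · rw [mkHom_app, hle 0 (n j) j (by simpa using hj) (hn j), ht₀]

end Lifting

/-! ### Replacing a representation by one with monic maps -/

section MonomorphicReplacement

variable {C : Type u} [Category.{v} C] [Abelian C] {𝒜 ℬ : ObjectProperty C}

lemma nonempty_path_iff {i j : ℤ} : Nonempty (vtx i ⟶ vtx j) ↔ j ≤ i :=
  ⟨fun ⟨p⟩ => toInt_le_of_path p, nonempty_path⟩

/-- For morphisms `ι i : X(i) ⟶ E i`, the universal representation `F` over `X` with compatible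
morphisms to all the constant representations `E i` that restrict to `ι i` at the vertices above
`i`. -/
lemma exists_universal_coaugmentation [HasLimitsOfSize.{0, 0} C] (X : QuiverRep InfiniteLine C)
    (E : ℤ → C) (ι : ∀ i : ℤ, X.obj (vtx i) ⟶ E i) :
    ∃ (F : QuiverRep InfiniteLine C) (p : F ⟶ X)
      (s : ∀ i : ℤ, F ⟶ (Functor.const (Paths InfiniteLine)).obj (E i)),
      (∀ x i (α : x ⟶ vtx i), p.app x ≫ X.map α ≫ ι i = (s i).app x) ∧
      (∀ x (T : C) (u v : T ⟶ F.obj x), u ≫ p.app x = v ≫ p.app x →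
        (∀ i, u ≫ (s i).app x = v ≫ (s i).app x) → u = v) ∧
      (∀ x (T : C) (u : T ⟶ X.obj x) (w : ∀ i, T ⟶ E i),
        (∀ i (α : x ⟶ vtx i), u ≫ X.map α ≫ ι i = w i) →
        ∃ l : T ⟶ F.obj x, l ≫ p.app x = u ∧ ∀ i, l ≫ (s i).app x = w i) := by
  -- F(x) consists of pairs (u, w) in X(x) × ∏ E(i) with w(i) equal to the image of u for i ≤ x;
  -- thus F(x) is X(x) × ∏_{i>x} E(i). The maps of F leave w unchanged.
  let a : ∀ x, X.obj x ⟶ ∏ᶜ fun i : {i : ℤ // Nonempty (x ⟶ vtx i)} => E i.1 := fun x =>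
    Pi.lift fun i => X.map i.2.some ≫ ι i.1
  let b : ∀ x : Paths InfiniteLine,
      ∏ᶜ E ⟶ ∏ᶜ fun i : {i : ℤ // Nonempty (x ⟶ vtx i)} => E i.1 := fun x =>
    Pi.lift fun i => Pi.π E i.1
  have cond : ∀ x i (α : x ⟶ vtx i),
      pullback.fst (a x) (b x) ≫ X.map α ≫ ι i = pullback.snd (a x) (b x) ≫ Pi.π E i := by
    intro x i α
    have := pullback.condition (f := a x) (g := b x) =≫ Pi.π _ ⟨i, ⟨α⟩⟩
    simp only [a, b, Category.assoc, limit.lift_π, Fan.mk_π_app] at this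
    rwa [Subsingleton.elim α (Nonempty.some ⟨α⟩)]
  have hm : ∀ {x y} (α : x ⟶ y), ∃ m : pullback (a x) (b x) ⟶ pullback (a y) (b y),
      m ≫ pullback.fst _ _ = pullback.fst _ _ ≫ X.map α ∧
        m ≫ pullback.snd _ _ = pullback.snd _ _ := fun {x y} α => by
    refine ⟨pullback.lift (pullback.fst _ _ ≫ X.map α) (pullback.snd _ _) ?_,
      pullback.lift_fst _ _ _, pullback.lift_snd _ _ _⟩
    refine Pi.hom_ext _ _ fun i => ?_
    have := cond x i.1 (α ≫ i.2.some)
    simpa [a, b] using this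
  choose m hm₁ hm₂ using @hm
  let F : QuiverRep InfiniteLine C :=
    { obj := fun x => pullback (a x) (b x)
      map := m
      map_id := fun x => by
        apply pullback.hom_ext
        · rw [hm₁, X.map_id, Category.id_comp, Category.comp_id]
        · rw [hm₂, Category.id_comp]
      map_comp := fun α β => by
        apply pullback.hom_ext
        · rw [hm₁, Category.assoc, hm₁, reassoc_of% (hm₁ α), X.map_comp]
        · rw [hm₂, Category.assoc, hm₂, hm₂] }
  refine ⟨F,
    { app := fun x => pullback.fst (a x) (b x)
      naturality := fun x y α => hm₁ α },
    fun i =>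
      { app := fun x => pullback.snd (a x) (b x) ≫ Pi.π E i
        naturality := fun x y α => ?_ }, cond, fun x T u v h₁ h₂ => ?_, fun x T u w h => ?_⟩
  · dsimp [F]
    rw [reassoc_of% (hm₂ α), Category.comp_id]
  · refine pullback.hom_ext h₁ (Pi.hom_ext _ _ fun i => ?_)
    simpa using h₂ i
  · refine ⟨pullback.lift u (Pi.lift w) (Pi.hom_ext _ _ fun i => ?_), pullback.lift_fst _ _ _,
      fun i => ?_⟩
    · simpa [a, b] using h i.1 i.2.some
    · dsimp
      rw [pullback.lift_snd_assoc, Pi.lift_π]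

/-- Every representation admits an epimorphism from a representation by monomorphisms which has the
right lifting property with respect to the monomorphisms with filtered cokernel. -/
lemma HereditaryPair.exists_monomorphic_replacement [HasLimitsOfSize.{0, 0} C]
    (h : HereditaryPair 𝒜 ℬ) (X : QuiverRep InfiniteLine C) :
    ∃ (F : QuiverRep InfiniteLine C) (p : F ⟶ X), (∀ j : ℤ, Mono (F.map (step j))) ∧
      (∀ j : ℤ, Epi (p.app (vtx j))) ∧ (monoWithCokernel (filteredRep 𝒜)).rlp p := by
  choose E A ι q w hA hE hS using fun i : ℤ => h.preenvelope (X.obj (vtx i))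
  have hι : ∀ i, Mono (ι i) := fun i => (hS i).mono_f
  obtain ⟨F, p, s, cond, ext, lift⟩ := exists_universal_coaugmentation X E ι
  refine ⟨F, p, fun j => ⟨fun {T} u v huv => ext _ _ _ _ ?_ fun i => ?_⟩, fun j => ?_,
    fun U V f hf => ⟨fun {a b} sq => ?_⟩⟩
  -- The E-components survive the map F(j+1) → F(j), and the one with index j+1 recovers the
  -- X(j+1)-component because ι(j+1) is monic.
  · have hs : ∀ i, u ≫ (s i).app (vtx (j + 1)) = v ≫ (s i).app (vtx (j + 1)) := fun i => by
      have := huv =≫ (s i).app (vtx j)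
      simpa using this
    have := hs (j + 1)
    rw [← cond _ _ (𝟙 _), X.map_id, Category.id_comp] at this
    rwa [← Category.assoc, ← Category.assoc, cancel_mono] at this
  · have := huv =≫ (s i).app (vtx j)
    simpa using this
  · classical
    -- A section of p at j: the free components, those with i > j, are set to zero.
    obtain ⟨l, hl, -⟩ := lift (vtx j) _ (𝟙 _)
      (fun i => if hα : Nonempty (vtx j ⟶ vtx i) then X.map hα.some ≫ ι i else 0)
      (fun i α => by
        rw [dif_pos ⟨α⟩, Category.id_comp, Subsingleton.elim α (Nonempty.some ⟨α⟩)])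
    have : Epi (l ≫ p.app (vtx j)) := by rw [hl]; infer_instance
    exact epi_of_epi l _
  -- At vertices j ≥ i the morphism V → E(i) is forced by b; below i it extends since E(i) → 0 is an
  -- epimorphism with kernel in ℬ.
  · have hl : ∀ i : ℤ, ∃ l : V ⟶ (Functor.const (Paths InfiniteLine)).obj (E i),
        f ≫ l = a ≫ s i ∧ ∀ (j : ℤ) (hj : i ≤ j),
          l.app (vtx j) = b.app (vtx j) ≫ X.map (path hj) ≫ ι i := by
      intro i
      obtain ⟨l, h₁, -, h₂⟩ := h.exists_lift_of_partialLift hf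
        (p := (0 : (Functor.const (Paths InfiniteLine)).obj (E i) ⟶
          (Functor.const (Paths InfiniteLine)).obj 0)) (a := a ≫ s i) (b := 0) ⟨by simp⟩ i
        (fun j _ => h.right_iff_epiWithKernel.1 (hE i))
        { app := fun j hj => b.app (vtx j) ≫ X.map (path hj) ≫ ι i
          fac_left := fun j hj => by
            rw [← NatTrans.comp_app_assoc, ← sq.w, NatTrans.comp_app_assoc, cond,
              NatTrans.comp_app]
          fac_right := fun j hj => by simp
          comm := fun j hj => by
            rw [b.naturality_assoc, ← X.map_comp_assoc, Subsingleton.elim (step j ≫ path hj)]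
            exact (Category.comp_id _).symm }
      exact ⟨l, h₁, h₂⟩
    choose l hl₁ hl₂ using hl
    have hl₁' : ∀ i x, f.app x ≫ (l i).app x = a.app x ≫ (s i).app x := fun i x => by
      rw [← NatTrans.comp_app, hl₁, NatTrans.comp_app]
    have hw' : ∀ x, f.app x ≫ b.app x = a.app x ≫ p.app x := fun x => by
      rw [← NatTrans.comp_app, ← sq.w, NatTrans.comp_app]
    choose m hm₁ hm₂ using fun j : ℤ => lift (vtx j) _ (b.app (vtx j))
      (fun i => (l i).app (vtx j)) (fun i α => by
        rw [hl₂ i j (nonempty_path_iff.1 ⟨α⟩),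
          Subsingleton.elim α (path (nonempty_path_iff.1 ⟨α⟩))])
    refine ⟨⟨⟨mkHom m fun j => ext _ _ _ _ ?_ fun i => ?_,
      repHom_ext fun j => ext _ _ _ _ ?_ fun i => ?_, repHom_ext fun j => ?_⟩⟩⟩
    · simp [hm₁, reassoc_of% hm₁]
    · simp [hm₂]
    · simp [hm₁, hw']
    · simp [hm₂, hl₁']
    · simp [hm₁]

end MonomorphicReplacement

/-- A compatible sequence of lifts with one prescribed member. -/
lemma exists_compatible_lifts (m : ℕ) {C : Type u} [Category.{v} C] {F : C} {W W' : ℕ → C}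
    (r : ∀ n, W (n + 1) ⟶ W n) (q : ∀ n, W' n ⟶ W n) (t : ∀ n, W' (n + 1) ⟶ W' n)
    (comm : ∀ n, q (n + 1) ≫ r n = t n ≫ q n)
    (step : ∀ n (y : F ⟶ W (n + 1)) (v : F ⟶ W' n), y ≫ r n = v ≫ q n →
      ∃ v' : F ⟶ W' (n + 1), v' ≫ q (n + 1) = y ∧ v' ≫ t n = v)
    (b : ∀ n, F ⟶ W n) (hb : ∀ n, b (n + 1) ≫ r n = b n) (β : F ⟶ W' m) (hβ : β ≫ q m = b m) :
    ∃ v : ∀ n, F ⟶ W' n, v m = β ∧ (∀ n, v n ≫ q n = b n) ∧ ∀ n, v (n + 1) ≫ t n = v n := by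
  induction m generalizing W W' with
  | zero =>
    obtain ⟨s, hs₀, hs⟩ := exists_seq (α := fun n => {v : F ⟶ W' n // v ≫ q n = b n})
      (fun n x y => y.1 ≫ t n = x.1) ⟨β, hβ⟩ (fun n x => by
        obtain ⟨v', h₁, h₂⟩ := step n (b (n + 1)) x.1 (by rw [hb, x.2])
        exact ⟨⟨v', h₁⟩, h₂⟩)
    exact ⟨fun n => (s n).1, by dsimp only; rw [hs₀], fun n => (s n).2, hs⟩
  | succ m ih =>
    obtain ⟨v, h₁, h₂, h₃⟩ := ih (fun n => r (n + 1)) (fun n => q (n + 1)) (fun n => t (n + 1))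
      (fun n => comm (n + 1)) (fun n => step (n + 1)) (fun n => b (n + 1)) (fun n => hb (n + 1))
      β hβ
    -- The induction drops level 0 of the towers; the lift at level 0 is the image of the one at
    -- level 1.
    refine ⟨fun n => match n with
      | 0 => v 0 ≫ t 0
      | n + 1 => v n, h₁, fun n => ?_, fun n => ?_⟩
    · cases n with
      | zero =>
        dsimp only
        rw [Category.assoc, ← comm, reassoc_of% (h₂ 0), hb]
      | succ n => exact h₂ n
    · cases n with
      | zero => rfl
      | succ n => exact h₃ n

/-! ### Resolutions and limits of towers -/

section Towers

variable {C : Type u} [Category.{v} C] [Abelian C] {𝒜 ℬ : ObjectProperty C}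

/-- A sequence of objects can be resolved by objects of `𝒜` such that all the relative transition
maps are epimorphisms with kernel in `ℬ`. -/
lemma HereditaryPair.exists_tower_resolution (h : HereditaryPair 𝒜 ℬ) (W : ℕ → C)
    (r : ∀ n, W (n + 1) ⟶ W n) (h₀ : 𝒜 (W 0)) [∀ n, Epi (r n)] :
    ∃ (W' : ℕ → C) (q : ∀ n, W' n ⟶ W n) (t : ∀ n, W' (n + 1) ⟶ W' n)
      (comm : ∀ n, q (n + 1) ≫ r n = t n ≫ q n),
      IsIso (q 0) ∧ (∀ n, 𝒜 (W' n)) ∧ (∀ n, Epi (t n) ∧ 𝒜 (kernel (t n))) ∧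
      ∀ n, epiWithKernel ℬ (pullback.lift _ _ (comm n)) := by
  have := h.isClosedUnderIsomorphisms_right
  -- W'(0) = W(0), and W'(n+1) is a special precover of W(n+1) ×_{W(n)} W'(n).
  obtain ⟨s, hs₀, hs⟩ := exists_seq (α := fun n => {T : Over (W n) // 𝒜 T.left})
    (fun n x y => ∃ (t : y.1.left ⟶ x.1.left) (comm : y.1.hom ≫ r n = t ≫ x.1.hom),
      epiWithKernel ℬ (pullback.lift _ _ comm)) ⟨Over.mk (𝟙 (W 0)), h₀⟩ (fun n x => by
      obtain ⟨B, A, i, p, w, hA, hB, hS⟩ := h.precover (pullback (r n) x.1.hom)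
      refine ⟨⟨Over.mk (p ≫ pullback.fst _ _), hA⟩, p ≫ pullback.snd _ _, ?_, ?_⟩
      · simp [pullback.condition]
      · have hp : epiWithKernel ℬ p := epiWithKernel_of_shortExact hS hB
        have e : pullback.lift (p ≫ pullback.fst (r n) x.1.hom) (p ≫ pullback.snd _ _)
            (by simp [pullback.condition]) = p := by
          exact pullback.hom_ext (pullback.lift_fst _ _ _) (pullback.lift_snd _ _ _)
        rw [← e] at hp
        exact hp)
  choose t comm ht using hs
  have ht' : ∀ n, Epi (t n) := fun n => by
    have := (ht n).1
    rw [← pullback.lift_snd _ _ (comm n)]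
    exact epi_comp _ _
  refine ⟨fun n => (s n).1.left, fun n => (s n).1.hom, t, comm, ?_, fun n => (s n).2,
    fun n => ⟨ht' n, ?_⟩, ht⟩
  · dsimp only
    rw [hs₀]
    exact inferInstanceAs (IsIso (𝟙 (W 0)))
  -- Here heredity is used: the kernel of an epimorphism between objects of 𝒜.
  · have := ht' n
    exact h.left_kernel _ (shortExact_kernel (t n)) (s (n + 1)).2 (s n).2

/-- The universal object over `X` with a compatible sequence of morphisms to the objects `W' n`. -/
lemma exists_tower_limit [HasLimitsOfSize.{0, 0} C] {X : C} {W W' : ℕ → C} (a : ∀ n, X ⟶ W n)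
    (q : ∀ n, W' n ⟶ W n) (t : ∀ n, W' (n + 1) ⟶ W' n) :
    ∃ (L : C) (x : L ⟶ X) (w : ∀ n, L ⟶ W' n),
      (∀ n, x ≫ a n = w n ≫ q n) ∧ (∀ n, w (n + 1) ≫ t n = w n) ∧
      (∀ (T : C) (b : T ⟶ X) (v : ∀ n, T ⟶ W' n), (∀ n, b ≫ a n = v n ≫ q n) →
        (∀ n, v (n + 1) ≫ t n = v n) → ∃ l : T ⟶ L, l ≫ x = b ∧ ∀ n, l ≫ w n = v n) ∧
      ∀ (T : C) (l l' : T ⟶ L), l ≫ x = l' ≫ x → (∀ n, l ≫ w n = l' ≫ w n) → l = l' := by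
  let y : X ⊞ ∏ᶜ W' ⟶ X := biprod.fst
  let z : ∀ n, X ⊞ ∏ᶜ W' ⟶ W' n := fun n => biprod.snd ≫ Pi.π W' n
  let φ : X ⊞ ∏ᶜ W' ⟶ ∏ᶜ fun n => W n ⊞ W' n :=
    Pi.lift fun n => biprod.lift (y ≫ a n - z n ≫ q n) (z (n + 1) ≫ t n - z n)
  have hφ : ∀ {T : C} (u : T ⟶ X ⊞ ∏ᶜ W'), u ≫ φ = 0 ↔
      (∀ n, u ≫ y ≫ a n = u ≫ z n ≫ q n) ∧ ∀ n, u ≫ z (n + 1) ≫ t n = u ≫ z n := by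
    intro T u
    refine ⟨fun hu => ?_, fun ⟨h₁, h₂⟩ => Pi.hom_ext _ _ fun n => ?_⟩
    · have hn : ∀ n, u ≫ biprod.lift (y ≫ a n - z n ≫ q n) (z (n + 1) ≫ t n - z n) = 0 := by
        intro n
        have := hu =≫ Pi.π _ n
        rwa [Category.assoc, Pi.lift_π, zero_comp] at this
      refine ⟨fun n => ?_, fun n => ?_⟩
      · have := hn n =≫ biprod.fst
        rwa [Category.assoc, biprod.lift_fst, zero_comp, Preadditive.comp_sub, sub_eq_zero] at this
      · have := hn n =≫ biprod.snd
        rwa [Category.assoc, biprod.lift_snd, zero_comp, Preadditive.comp_sub, sub_eq_zero] at this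
    · rw [Category.assoc, Pi.lift_π, zero_comp]
      apply biprod.hom_ext
      · rw [Category.assoc, biprod.lift_fst, zero_comp, Preadditive.comp_sub, sub_eq_zero]
        exact h₁ n
      · rw [Category.assoc, biprod.lift_snd, zero_comp, Preadditive.comp_sub, sub_eq_zero]
        exact h₂ n
  have hk := (hφ (kernel.ι φ)).1 (kernel.condition φ)
  refine ⟨kernel φ, kernel.ι φ ≫ y, fun n => kernel.ι φ ≫ z n, fun n => by simpa using hk.1 n,
    fun n => by simpa using hk.2 n, fun T b v h₁ h₂ => ?_, fun T l l' h₁ h₂ => ?_⟩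
  · have hy : biprod.lift b (Pi.lift v) ≫ y = b := biprod.lift_fst _ _
    have hz : ∀ n, biprod.lift b (Pi.lift v) ≫ z n = v n := fun n => by
      rw [biprod.lift_snd_assoc, Pi.lift_π]
    refine ⟨kernel.lift φ (biprod.lift b (Pi.lift v)) ((hφ _).2 ⟨fun n => ?_, fun n => ?_⟩), ?_,
      fun n => ?_⟩
    · rw [reassoc_of% hy, reassoc_of% (hz n), h₁]
    · rw [reassoc_of% (hz (n + 1)), hz, h₂]
    · rw [kernel.lift_ι_assoc, hy]
    · rw [kernel.lift_ι_assoc, hz]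
  · rw [← cancel_mono (kernel.ι φ)]
    refine biprod.hom_ext _ _ (by simpa using h₁) (Pi.hom_ext _ _ fun n => by simpa using h₂ n)

/-- For f = L → W'(n+1) and g = W'(n+1) → W'(n), this computes the successive quotients of the
kernels of L → W'(n). -/
lemma shortExact_kernel_comp {X Y Z : C} (f : X ⟶ Y) (g : Y ⟶ Z) [Epi f] :
    (ShortComplex.mk (kernel.lift (f ≫ g) (kernel.ι f) (by simp) : kernel f ⟶ kernel (f ≫ g))
      (kernel.lift g (kernel.ι (f ≫ g) ≫ f) (by simp))
      (by rw [← cancel_mono (kernel.ι g)]; simp)).ShortExact := by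
  have hmono : Mono (kernel.lift (f ≫ g) (kernel.ι f) (by simp)) := by
    have : Mono (kernel.lift (f ≫ g) (kernel.ι f) (by simp) ≫ kernel.ι _) := by
      rw [kernel.lift_ι]
      infer_instance
    exact mono_of_mono _ (kernel.ι _)
  have hepi : Epi (kernel.lift g (kernel.ι (f ≫ g) ≫ f) (by simp)) := by
    rw [epi_iff_surjective_up_to_refinements]
    intro T y
    obtain ⟨T', π, hπ, x, hx⟩ := surjective_up_to_refinements_of_epi f (y ≫ kernel.ι g)
    refine ⟨T', π, hπ, kernel.lift _ x ?_, ?_⟩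
    · rw [← Category.assoc, ← hx]
      simp
    · rw [← cancel_mono (kernel.ι g)]
      simpa using hx
  refine ⟨ShortComplex.exact_of_f_is_kernel _ (KernelFork.IsLimit.ofι' _ _ fun {T} k hk => ?_)⟩
  dsimp at k hk
  have hk' : (k ≫ kernel.ι (f ≫ g)) ≫ f = 0 := by
    have := hk =≫ kernel.ι g
    simpa using this
  refine ⟨kernel.lift f _ hk', ?_⟩
  dsimp
  rw [← cancel_mono (kernel.ι (f ≫ g))]
  simp

end Towers

/-! ### Gluing nonnegative and negative parts -/

section Glue

variable {C : Type u} [Category.{v} C]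

/-- The three cases are the arrows between nonnegative vertices, the arrow 0 → -1, and those between
negative vertices, `Int.negSucc n` being -n-1. -/
lemma arrow_cases {Q : ∀ {i j : ℤ}, (vtx i ⟶ vtx j) → Prop}
    (h₁ : ∀ n : ℕ, Q (arrow (i := (n + 1 : ℕ)) (j := (n : ℕ)) (by simp)))
    (h₂ : Q (arrow (i := (0 : ℕ)) (j := Int.negSucc 0) rfl))
    (h₃ : ∀ n : ℕ, Q (arrow (i := Int.negSucc n) (j := Int.negSucc (n + 1)) rfl)) (j : ℤ) :
    Q (step j) := by
  suffices H : ∀ {i j : ℤ} (h : i = j + 1), Q (arrow h) from H rfl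
  intro i j h
  match j, h with
  | Int.ofNat n, h =>
    obtain rfl : i = ((n + 1 : ℕ) : ℤ) := h
    exact h₁ n
  | Int.negSucc 0, h =>
    obtain rfl : i = ((0 : ℕ) : ℤ) := h
    exact h₂
  | Int.negSucc (n + 1), h =>
    obtain rfl : i = Int.negSucc n := h
    exact h₃ n

/-- A representation over `X` glued from a nonnegative and a negative part. -/
lemma exists_glued_rep (X : QuiverRep InfiniteLine C) (P : ℕ → C) (d : ∀ n, P (n + 1) ⟶ P n)
    (p : ∀ n : ℕ, P n ⟶ X.obj (vtx n))
    (hp : ∀ n : ℕ, d n ≫ p n = p (n + 1) ≫ X.map (arrow (by simp)))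
    (N : ℕ → C) (π : ∀ n : ℕ, N n ⟶ X.obj (vtx (Int.negSucc n))) (δ₀ : P 0 ⟶ N 0)
    (δ : ∀ n, N n ⟶ N (n + 1))
    (hδ₀ : δ₀ ≫ π 0 = p 0 ≫ X.map (arrow (i := (0 : ℕ)) (j := Int.negSucc 0) rfl))
    (hδ : ∀ n, δ n ≫ π (n + 1) =
      π n ≫ X.map (arrow (i := Int.negSucc n) (j := Int.negSucc (n + 1)) rfl)) :
    ∃ (F : QuiverRep InfiniteLine C) (f : F ⟶ X) (e : ∀ n : ℕ, F.obj (vtx n) ≅ P n)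
      (e' : ∀ n : ℕ, F.obj (vtx (Int.negSucc n)) ≅ N n),
      (∀ n : ℕ, F.map (arrow (i := (n + 1 : ℕ)) (j := (n : ℕ)) (by simp)) =
        (e (n + 1)).hom ≫ d n ≫ (e n).inv) ∧
      F.map (arrow (i := (0 : ℕ)) (j := Int.negSucc 0) rfl) = (e 0).hom ≫ δ₀ ≫ (e' 0).inv ∧
      (∀ n : ℕ, F.map (arrow (i := Int.negSucc n) (j := Int.negSucc (n + 1)) rfl) =
        (e' n).hom ≫ δ n ≫ (e' (n + 1)).inv) ∧
      (∀ n : ℕ, f.app (vtx n) = (e n).hom ≫ p n) ∧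
      ∀ n : ℕ, f.app (vtx (Int.negSucc n)) = (e' n).hom ≫ π n := by
  let M : ℤ → C := fun j => match j with
    | Int.ofNat n => P n
    | Int.negSucc n => N n
  let D : ∀ j, M (j + 1) ⟶ M j := fun j => match j with
    | Int.ofNat n => d n
    | Int.negSucc 0 => δ₀
    | Int.negSucc (n + 1) => δ n
  let e : ∀ n : ℕ, (mkRep M D).obj (vtx n) ≅ P n := fun n => Iso.refl (P n)
  let e' : ∀ n : ℕ, (mkRep M D).obj (vtx (Int.negSucc n)) ≅ N n := fun n => Iso.refl (N n)
  have hd : ∀ n : ℕ, (mkRep M D).map (arrow (i := (n + 1 : ℕ)) (j := (n : ℕ)) (by simp)) =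
      (e (n + 1)).hom ≫ d n ≫ (e n).inv := fun n =>
    (mkRep_map_step M D (n : ℕ)).trans
      ((Category.id_comp (d n ≫ 𝟙 _)).trans (Category.comp_id (d n))).symm
  have hd₀ : (mkRep M D).map (arrow (i := (0 : ℕ)) (j := Int.negSucc 0) rfl) =
      (e 0).hom ≫ δ₀ ≫ (e' 0).inv :=
    (mkRep_map_step M D (Int.negSucc 0)).trans
      ((Category.id_comp (δ₀ ≫ 𝟙 _)).trans (Category.comp_id δ₀)).symm
  have hd' : ∀ n : ℕ,
      (mkRep M D).map (arrow (i := Int.negSucc n) (j := Int.negSucc (n + 1)) rfl) =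
      (e' n).hom ≫ δ n ≫ (e' (n + 1)).inv := fun n =>
    (mkRep_map_step M D (Int.negSucc (n + 1))).trans
      ((Category.id_comp (δ n ≫ 𝟙 _)).trans (Category.comp_id (δ n))).symm
  let f : ∀ i : ℤ, (mkRep M D).obj (vtx i) ⟶ X.obj (vtx i) := fun i => match i with
    | Int.ofNat n => (e n).hom ≫ p n
    | Int.negSucc n => (e' n).hom ≫ π n
  refine ⟨mkRep M D, mkHom f (arrow_cases (Q := fun {i j} α =>
    (mkRep M D).map α ≫ f j = f i ≫ X.map α) (fun n => ?_) ?_ fun n => ?_), e, e', hd, hd₀, hd',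
    fun n => rfl, fun n => rfl⟩
  · change _ ≫ (e n).hom ≫ p n = ((e (n + 1)).hom ≫ p (n + 1)) ≫ _
    rw [hd, Category.assoc, Category.assoc, Iso.inv_hom_id_assoc, hp, Category.assoc]
  · change _ ≫ (e' 0).hom ≫ π 0 = ((e 0).hom ≫ p 0) ≫ _
    rw [hd₀, Category.assoc, Category.assoc, Iso.inv_hom_id_assoc, hδ₀, Category.assoc]
  · change _ ≫ (e' (n + 1)).hom ≫ π (n + 1) = ((e' n).hom ≫ π n) ≫ _
    rw [hd', Category.assoc, Category.assoc, Iso.inv_hom_id_assoc, hδ, Category.assoc]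

end Glue

/-! ### Filtered covers -/

section FilteredCover

variable {C : Type u} [Category.{v} C]

lemma map_mem_of_map_step_mem (W : MorphismProperty C) [W.IsMultiplicative]
    {X : QuiverRep InfiniteLine C} (hX : ∀ j : ℤ, W (X.map (step j))) {x y : Paths InfiniteLine}
    (α : x ⟶ y) : W (X.map α) := by
  have H : W.inverseImage X = ⊤ := by
    refine Paths.morphismProperty_eq_top_of_isMultiplicative _ _ fun {u v} a => ?_
    have H' : ∀ {i j : ℤ} (h : i = j + 1), W (X.map (arrow h)) := by
      rintro _ j rfl
      exact hX j
    exact H' (toInt_of_hom a)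
  exact (show W.inverseImage X α by rw [H]; trivial)

/-- The path from the vertex `n` to the vertex `0`, for a natural number `n`. -/
def pathToZero (n : ℕ) : vtx (n : ℤ) ⟶ vtx ((0 : ℕ) : ℤ) := path (by simp)

/-- The arrow from the vertex `n + 1` to the vertex `n`, for a natural number `n`. -/
def natArrow (n : ℕ) : vtx ((n + 1 : ℕ) : ℤ) ⟶ vtx (n : ℤ) := arrow (by simp)

lemma map_natArrow_pathToZero (X : QuiverRep InfiniteLine C) (n : ℕ) :
    X.map (natArrow n) ≫ X.map (pathToZero n) = X.map (pathToZero (n + 1)) := by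
  rw [← X.map_comp, Subsingleton.elim (natArrow n ≫ pathToZero n)]

variable [Abelian C] {𝒜 ℬ : ObjectProperty C}

lemma HereditaryPair.filteredRep_map (h : HereditaryPair 𝒜 ℬ) {X : QuiverRep InfiniteLine C}
    (hX : filteredRep 𝒜 X) {x y : Paths InfiniteLine} (α : x ⟶ y) :
    monoWithCokernel 𝒜 (X.map α) := by
  have := map_mem_of_map_step_mem (epiWithKernel ℬ).llp (X := X)
    (fun j => by rw [h.llp_eq]; exact hX j) α
  rwa [h.llp_eq] at this

/-- The nonnegative part of a cover of a representation by monomorphisms. -/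
lemma HereditaryPair.exists_nonnegative_cover [HasLimitsOfSize.{0, 0} C] [EnoughProjectives C]
    (h : HereditaryPair 𝒜 ℬ) (X : QuiverRep InfiniteLine C)
    (hX : ∀ j : ℤ, Mono (X.map (step j))) :
    ∃ (P : ℕ → C) (d : ∀ n, P (n + 1) ⟶ P n) (p : ∀ n : ℕ, P n ⟶ X.obj (vtx n)),
      (∀ n, d n ≫ p n = p (n + 1) ≫ X.map (natArrow n)) ∧
      (∀ n, monoWithCokernel 𝒜 (d n)) ∧ (∀ n, Epi (p n)) ∧
      ∀ (U V : QuiverRep InfiniteLine C) (f : U ⟶ V), monoWithCokernel (filteredRep 𝒜) f →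
        ∀ (a : ∀ n : ℕ, U.obj (vtx n) ⟶ P n) (b : V ⟶ X),
        (∀ n, U.map (natArrow n) ≫ a n = a (n + 1) ≫ d n) →
        (∀ n : ℕ, f.app (vtx n) ≫ b.app (vtx n) = a n ≫ p n) →
        ∃ s : ∀ n : ℕ, V.obj (vtx n) ⟶ P n,
          (∀ n : ℕ, f.app (vtx n) ≫ s n = a n) ∧ (∀ n : ℕ, s n ≫ p n = b.app (vtx n)) ∧
          ∀ n, V.map (natArrow n) ≫ s n = s (n + 1) ≫ d n := by
  have hmono : ∀ n, Mono (X.map (pathToZero n)) := fun n =>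
    map_mem_of_map_step_mem (MorphismProperty.monomorphisms C) hX (pathToZero n)
  -- W(n) = X(0)/X(n); in particular W(0) = 0, which starts the resolution of the tower.
  let W : ℕ → C := fun n => cokernel (X.map (pathToZero n))
  let c : ∀ n, X.obj (vtx ((0 : ℕ) : ℤ)) ⟶ W n := fun n => cokernel.π (X.map (pathToZero n))
  let r : ∀ n, W (n + 1) ⟶ W n := fun n => cokernel.desc _ (c n) (by
    rw [← map_natArrow_pathToZero, Category.assoc, cokernel.condition, comp_zero])
  have hc : ∀ n, c (n + 1) ≫ r n = c n := fun n => cokernel.π_desc _ _ _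
  have hXc : ∀ n, X.map (pathToZero n) ≫ c n = 0 := fun n => cokernel.condition _
  have hr : ∀ n, Epi (r n) := fun n => by
    have : Epi (c (n + 1) ≫ r n) := by rw [hc]; infer_instance
    exact epi_of_epi (c (n + 1)) (r n)
  have hW₀ : 𝒜 (W 0) := by
    have e : X.map (pathToZero 0) = 𝟙 _ := by
      rw [Subsingleton.elim (pathToZero 0) (𝟙 _), X.map_id]
    have := (h.monoWithCokernel_id (X.obj (vtx ((0 : ℕ) : ℤ)))).2
    rw [← e] at this
    exact this
  obtain ⟨W', q, t, comm, hq₀, hW', ht, hR⟩ := h.exists_tower_resolution W r hW₀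
  obtain ⟨L, x, w, hxw, hwt, hlift, hext⟩ := exists_tower_limit c q t
  -- Limits of towers need not be exact, but morphisms from a projective object into L can be chosen
  -- level by level, with level m prescribed. This suffices to detect the epimorphisms below.
  have hproj : ∀ (m : ℕ) (F : C) [Projective F] (α : F ⟶ X.obj (vtx ((0 : ℕ) : ℤ)))
      (β : F ⟶ W' m), β ≫ q m = α ≫ c m → ∃ l : F ⟶ L, l ≫ x = α ∧ l ≫ w m = β := by
    intro m F _ α β hβ
    obtain ⟨v, h₁, h₂, h₃⟩ := exists_compatible_lifts m r q t comm (fun n y v hv => by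
      have := (hR n).1
      refine ⟨Projective.factorThru (pullback.lift y v hv) (pullback.lift _ _ (comm n)), ?_, ?_⟩
      · have := Projective.factorThru_comp (pullback.lift y v hv)
          (pullback.lift _ _ (comm n)) =≫ pullback.fst _ _
        rwa [Category.assoc, pullback.lift_fst, pullback.lift_fst] at this
      · have := Projective.factorThru_comp (pullback.lift y v hv)
          (pullback.lift _ _ (comm n)) =≫ pullback.snd _ _
        rwa [Category.assoc, pullback.lift_snd, pullback.lift_snd] at this)
      (fun n => α ≫ c n) (fun n => by rw [Category.assoc, hc]) β hβ
    obtain ⟨l, hl₁, hl₂⟩ := hlift F α v (fun n => (h₂ n).symm) h₃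
    exact ⟨l, hl₁, by rw [hl₂, h₁]⟩
  have hw : ∀ n, Epi (w n) := fun n => by
    obtain ⟨l, -, hl⟩ := hproj n (Projective.over (W' n))
      (Projective.factorThru (Projective.π (W' n) ≫ q n) (c n)) (Projective.π (W' n))
      (Projective.factorThru_comp _ _).symm
    have : Epi (l ≫ w n) := by rw [hl]; infer_instance
    exact epi_of_epi l (w n)
  have hS : ∀ n, (ShortComplex.mk _ _ (hXc n)).ShortExact := fun n => shortExact_cokernel _
  have hk : ∀ n, (kernel.ι (w n) ≫ x) ≫ c n = 0 := fun n => by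
    rw [Category.assoc, hxw, kernel.condition_assoc, zero_comp]
  -- The kernel P(n) of L → W'(n) maps to the kernel X(n) of X(0) → W(n).
  let p : ∀ n : ℕ, kernel (w n) ⟶ X.obj (vtx n) := fun n => (hS n).exact.lift _ (hk n)
  have hp : ∀ n, p n ≫ X.map (pathToZero n) = kernel.ι (w n) ≫ x := fun n =>
    (hS n).exact.lift_f _ (hk n)
  let d : ∀ n, kernel (w (n + 1)) ⟶ kernel (w n) := fun n =>
    kernel.lift (w n) (kernel.ι (w (n + 1))) (by rw [← hwt n, kernel.condition_assoc, zero_comp])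
  have hd : ∀ n, d n ≫ kernel.ι (w n) = kernel.ι (w (n + 1)) := fun n => kernel.lift_ι _ _ _
  refine ⟨fun n => kernel (w n), d, p, fun n => ?_, fun n => ?_, fun n => ?_, ?_⟩
  · rw [← cancel_mono (X.map (pathToZero n)), Category.assoc, Category.assoc, hp,
      map_natArrow_pathToZero, hp, ← Category.assoc, hd]
  -- P(n)/P(n+1) is the kernel of W'(n+1) → W'(n), which lies in 𝒜.
  · have := h.isClosedUnderIsomorphisms_left
    have hn := shortExact_kernel_comp (w (n + 1)) (t n)
    have e : d n = kernel.lift (w (n + 1) ≫ t n) (kernel.ι (w (n + 1))) (by simp) ≫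
        (kernelIsoOfEq (hwt n)).hom := by
      rw [← cancel_mono (kernel.ι (w n)), hd]
      simp
    rw [e]
    refine h.monoWithCokernel_comp (monoWithCokernel_of_shortExact hn (ht n).2) ?_
    rw [← h.llp_eq]
    exact MorphismProperty.llp_of_isIso _ _
  -- Prescribing the component 0 in W'(n) makes the morphism land in P(n).
  · obtain ⟨l, hl₁, hl₂⟩ := hproj n (Projective.over (X.obj (vtx n)))
      (Projective.π _ ≫ X.map (pathToZero n)) 0 (by
        rw [Category.assoc, hXc, comp_zero, zero_comp])
    have : kernel.lift (w n) l hl₂ ≫ p n = Projective.π _ := by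
      rw [← cancel_mono (X.map (pathToZero n)), Category.assoc, hp, kernel.lift_ι_assoc, hl₁]
    have : Epi (kernel.lift (w n) l hl₂ ≫ p n) := by rw [this]; infer_instance
    exact epi_of_epi (kernel.lift (w n) l hl₂) _
  · intro U V f hf a b ha hab
    have := hf.1
    have ha' : ∀ n, U.map (pathToZero n) ≫ a 0 ≫ kernel.ι (w 0) = a n ≫ kernel.ι (w n) := by
      intro n
      induction n with
      | zero =>
        rw [Subsingleton.elim (pathToZero 0) (𝟙 _), U.map_id, Category.id_comp]
      | succ n ih =>
        rw [← map_natArrow_pathToZero, Category.assoc, ih, reassoc_of% (ha n), hd]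
    obtain ⟨a₀, ha₀⟩ : ∃ a₀, a₀ = a 0 ≫ kernel.ι (w 0) := ⟨_, rfl⟩
    rw [← ha₀] at ha'
    have hab₀ : f.app (vtx ((0 : ℕ) : ℤ)) ≫ b.app (vtx ((0 : ℕ) : ℤ)) = a₀ ≫ x := by
      have e : X.map (pathToZero 0) = 𝟙 _ := by
        rw [Subsingleton.elim (pathToZero 0) (𝟙 _), X.map_id]
      have := hp 0
      rw [e, Category.comp_id] at this
      rw [hab, ha₀, Category.assoc, this]
    have hUa : ∀ n, U.map (pathToZero n) ≫ a₀ ≫ w n = 0 := fun n => by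
      rw [reassoc_of% (ha' n), kernel.condition, comp_zero]
    have hVb : ∀ n, V.map (pathToZero n) ≫ b.app (vtx ((0 : ℕ) : ℤ)) ≫ c n = 0 := fun n => by
      rw [b.naturality_assoc, hXc, comp_zero]
    -- A lift at all n ≥ 0 is one morphism V(0) → L carrying V(n) into P(n). Its component in W'(n)
    -- must agree with a₀ on U(0), kill V(n) and lie over b. The next component is a relative lift
    -- along V(n+1) → V(0) against W'(n+1) → W(n+1) ×_{W(n)} W'(n).
    obtain ⟨v, -, hv⟩ := exists_seq
      (α := fun n => {v : V.obj (vtx ((0 : ℕ) : ℤ)) ⟶ W' n //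
        f.app _ ≫ v = a₀ ≫ w n ∧ V.map (pathToZero n) ≫ v = 0 ∧
          v ≫ q n = b.app (vtx ((0 : ℕ) : ℤ)) ≫ c n})
      (fun n y z => z.1 ≫ t n = y.1)
      ⟨b.app (vtx ((0 : ℕ) : ℤ)) ≫ c 0 ≫ inv (q 0), by
        rw [reassoc_of% hab₀, ← Category.assoc x, hxw]; simp, by
        rw [reassoc_of% (hVb 0), zero_comp], by simp⟩
      (fun n y => by
        obtain ⟨y, hy₁, hy₂, hy₃⟩ := y
        obtain ⟨z, hz₁, hz₂, hz₃⟩ := h.exists_relative_lift_app f (pathToZero (n + 1))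
          (h.filteredRep_map hf.2 _) _ (hR n) 0 (a₀ ≫ w (n + 1))
          (by rw [comp_zero, hUa])
          (pullback.lift (b.app (vtx ((0 : ℕ) : ℤ)) ≫ c (n + 1)) y (by
            rw [Category.assoc, hc, hy₃]))
          (by
            rw [zero_comp]
            apply pullback.hom_ext
            · rw [zero_comp, Category.assoc, pullback.lift_fst, hVb]
            · rw [zero_comp, Category.assoc, pullback.lift_snd, ← map_natArrow_pathToZero,
                Category.assoc, hy₂, comp_zero])
          (by
            apply pullback.hom_ext
            · rw [Category.assoc, Category.assoc, Category.assoc, pullback.lift_fst,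
                pullback.lift_fst, ← hxw, ← Category.assoc, ← hab₀, Category.assoc]
            · rw [Category.assoc, Category.assoc, Category.assoc, pullback.lift_snd,
                pullback.lift_snd, hwt, hy₁])
        refine ⟨⟨z, hz₁, hz₂, ?_⟩, ?_⟩
        · have := hz₃ =≫ pullback.fst _ _
          rwa [Category.assoc, pullback.lift_fst, pullback.lift_fst] at this
        · have := hz₃ =≫ pullback.snd _ _
          rwa [Category.assoc, pullback.lift_snd, pullback.lift_snd] at this)
    obtain ⟨l, hl₁, hl₂⟩ := hlift _ (b.app (vtx ((0 : ℕ) : ℤ))) (fun n => (v n).1)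
      (fun n => (v n).2.2.2.symm) hv
    have hfl : f.app (vtx ((0 : ℕ) : ℤ)) ≫ l = a₀ := hext _ _ _
      (by rw [Category.assoc, hl₁, hab₀]) fun n => by rw [Category.assoc, hl₂, (v n).2.1]
    refine ⟨fun n => kernel.lift (w n) (V.map (pathToZero n) ≫ l) (by
      rw [Category.assoc, hl₂, (v n).2.2.1]), fun n => ?_, fun n => ?_, fun n => ?_⟩
    · rw [← cancel_mono (kernel.ι (w n)), Category.assoc, kernel.lift_ι, ← f.naturality_assoc, hfl,
        ha']
    · rw [← cancel_mono (X.map (pathToZero n)), Category.assoc, hp, kernel.lift_ι_assoc,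
        Category.assoc, hl₁, b.naturality]
    · rw [← cancel_mono (kernel.ι (w n)), Category.assoc, Category.assoc, hd, kernel.lift_ι,
        kernel.lift_ι, ← Category.assoc, map_natArrow_pathToZero]

/-- A representation by monomorphisms admits a cover by a filtered one. -/
lemma HereditaryPair.exists_filtered_cover_of_mono [HasLimitsOfSize.{0, 0} C] [EnoughProjectives C]
    (h : HereditaryPair 𝒜 ℬ) (X : QuiverRep InfiniteLine C)
    (hX : ∀ j : ℤ, Mono (X.map (step j))) :
    ∃ (F : QuiverRep InfiniteLine C) (f : F ⟶ X), filteredRep 𝒜 F ∧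
      (∀ j : ℤ, Epi (f.app (vtx j))) ∧ (monoWithCokernel (filteredRep 𝒜)).rlp f := by
  have hiso : ∀ {A B : C} (e : A ≅ B), monoWithCokernel 𝒜 e.hom := fun e => by
    rw [← h.llp_eq]
    exact MorphismProperty.llp_of_isIso _ _
  have hisoR : ∀ {A B D : C} (e : A ≅ B) (g : B ⟶ D), epiWithKernel ℬ g →
      epiWithKernel ℬ (e.hom ≫ g) := fun e g hg => by
    rw [← h.rlp_eq] at hg ⊢
    exact MorphismProperty.comp_mem _ _ _ (MorphismProperty.rlp_of_isIso _ _) hg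
  obtain ⟨P, d, p, hp, hd, hpe, hl⟩ := h.exists_nonnegative_cover X hX
  -- Below 0, factoring F(j+1) → X(j+1) → X(j) yields at once the map F(j+1) → F(j), with cokernel
  -- in 𝒜, and the component F(j) → X(j), with kernel in ℬ.
  obtain ⟨N₀, δ₀, π₀, hδ₀, hπ₀, hc₀⟩ := h.exists_factorization
    (p 0 ≫ X.map (arrow (i := (0 : ℕ)) (j := Int.negSucc 0) rfl))
  obtain ⟨s, hs₀, hs⟩ := exists_seq
    (α := fun n : ℕ => {T : Over (X.obj (vtx (Int.negSucc n))) // epiWithKernel ℬ T.hom})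
    (fun n y z => ∃ δ : y.1.left ⟶ z.1.left, monoWithCokernel 𝒜 δ ∧ δ ≫ z.1.hom =
      y.1.hom ≫ X.map (arrow (i := Int.negSucc n) (j := Int.negSucc (n + 1)) rfl))
    ⟨Over.mk π₀, hπ₀⟩ (fun n y => by
      obtain ⟨N, δ, π, hδ, hπ, hc⟩ := h.exists_factorization
        (y.1.hom ≫ X.map (arrow (i := Int.negSucc n) (j := Int.negSucc (n + 1)) rfl))
      exact ⟨⟨Over.mk π, hπ⟩, δ, hδ, hc⟩)
  choose δ hδ hδc using hs
  obtain ⟨δ₀', hδ₀', hc₀'⟩ : ∃ δ₀' : P 0 ⟶ (s 0).1.left, monoWithCokernel 𝒜 δ₀' ∧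
      δ₀' ≫ (s 0).1.hom = p 0 ≫ X.map (arrow (i := (0 : ℕ)) (j := Int.negSucc 0) rfl) := by
    rw [hs₀]
    exact ⟨δ₀, hδ₀, hc₀⟩
  obtain ⟨F, f, e, e', hF, hF₀, hF', hf, hf'⟩ := exists_glued_rep X P d p hp
    (fun n => (s n).1.left) (fun n => (s n).1.hom) δ₀' δ hc₀' hδc
  have hneg : ∀ j : ℤ, j < 0 → epiWithKernel ℬ (f.app (vtx j)) := fun j hj => by
    obtain ⟨n, rfl⟩ := Int.eq_negSucc_of_lt_zero hj
    rw [hf']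
    exact hisoR _ _ (s n).2
  refine ⟨F, f, arrow_cases (Q := fun α => monoWithCokernel 𝒜 (F.map α)) (fun n => ?_) ?_
    fun n => ?_, fun j => ?_, fun U V g hg => ⟨fun {a b} sq => ?_⟩⟩
  · rw [hF]
    exact h.monoWithCokernel_comp (hiso _) (h.monoWithCokernel_comp (hd n) (hiso (e n).symm))
  · rw [hF₀]
    exact h.monoWithCokernel_comp (hiso _) (h.monoWithCokernel_comp hδ₀' (hiso (e' 0).symm))
  · rw [hF']
    exact h.monoWithCokernel_comp (hiso _) (h.monoWithCokernel_comp (hδ n) (hiso (e' (n + 1)).symm))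
  · match j with
    | Int.ofNat n =>
      change Epi (f.app (vtx (n : ℤ)))
      have := hpe n
      rw [hf]
      exact epi_comp _ _
    | Int.negSucc n => exact (hneg _ (Int.negSucc_lt_zero n)).1
  -- The nonnegative cover supplies a partial lift at all j ≥ 0, which then extends downwards.
  · obtain ⟨l, hl₁, hl₂, hl₃⟩ := hl U V g hg (fun n => a.app (vtx n) ≫ (e n).hom) b
      (fun n => by
        have := a.naturality (natArrow n)
        rw [reassoc_of% this, show F.map (natArrow n) = _ from hF n]
        simp) (fun n => by
        rw [Category.assoc, ← hf, ← NatTrans.comp_app, ← NatTrans.comp_app, sq.w])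
    have hs : ∃ S : PartialLift g f a b 0, True := by
      refine ⟨⟨fun j hj => match j, hj with
        | Int.ofNat n, _ => l n ≫ (e n).inv, ?_, ?_, ?_⟩, trivial⟩
      · intro j hj
        match j, hj with
        | Int.ofNat n, _ =>
          change g.app (vtx (n : ℤ)) ≫ l n ≫ (e n).inv = a.app (vtx (n : ℤ))
          rw [reassoc_of% (hl₁ n), Iso.hom_inv_id, Category.comp_id]
      · intro j hj
        match j, hj with
        | Int.ofNat n, _ =>
          change (l n ≫ (e n).inv) ≫ f.app (vtx n) = b.app (vtx n)
          rw [hf, Category.assoc, Iso.inv_hom_id_assoc, hl₂]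
      · intro j hj
        match j, hj with
        | Int.ofNat n, _ =>
          change V.map (natArrow n) ≫ l n ≫ (e n).inv =
            (l (n + 1) ≫ (e (n + 1)).inv) ≫ F.map (natArrow n)
          rw [show F.map (natArrow n) = _ from hF n, reassoc_of% (hl₃ n)]
          simp
    obtain ⟨S, -⟩ := hs
    obtain ⟨m, hm₁, hm₂, -⟩ := h.exists_lift_of_partialLift hg sq 0 hneg S
    exact ⟨⟨⟨m, hm₁, hm₂⟩⟩⟩

/-- Every representation of the line has a filtered cover with the right lifting property with
respect to the monomorphisms with filtered cokernel. -/
theorem HereditaryPair.exists_filtered_cover [HasLimitsOfSize.{0, 0} C] [EnoughProjectives C]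
    (h : HereditaryPair 𝒜 ℬ) (X : QuiverRep InfiniteLine C) :
    ∃ (F : QuiverRep InfiniteLine C) (f : F ⟶ X), filteredRep 𝒜 F ∧ Epi f ∧
      (monoWithCokernel (filteredRep 𝒜)).rlp f := by
  obtain ⟨Y, p, hY, hp, hp'⟩ := h.exists_monomorphic_replacement X
  obtain ⟨F, f, hF, hf, hf'⟩ := h.exists_filtered_cover_of_mono Y hY
  have : ∀ x, Epi ((f ≫ p).app x) := fun x => by
    have h₁ : Epi (f.app x) := hf (toInt x)
    have h₂ : Epi (p.app x) := hp (toInt x)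
    exact epi_comp (f.app x) (p.app x)
  exact ⟨F, f ≫ p, hF, NatTrans.epi_of_epi_app _, MorphismProperty.comp_mem _ _ _ hf' hp'⟩

end FilteredCover

/-! ### Projective representations -/

section EnoughProjectives

variable {C : Type u} [Category.{v} C] [Abelian C]

/-- Functor categories have enough projectives, coproducts of the left adjoints of the evaluation
functors applied to projective objects. -/
lemma enoughProjectives_functor {J : Type u'} [Category.{v'} J] [HasCoproductsOfShape J C]
    [∀ a b : J, HasCoproductsOfShape (a ⟶ b) C] [EnoughProjectives C] :
    EnoughProjectives (J ⥤ C) where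
  presentation X := by
    let Q : J → (J ⥤ C) := fun j =>
      (evaluationLeftAdjoint C j).obj (Projective.over (X.obj j))
    have hQ : ∀ j, Projective (Q j) := fun j =>
      (evaluationAdjunctionRight C j).map_projective _ inferInstance
    let f : ∀ j, Q j ⟶ X := fun j =>
      ((evaluationAdjunctionRight C j).homEquiv _ _).symm (Projective.π (X.obj j))
    have hf : ∀ j, Epi ((Sigma.desc f).app j) := fun j => by
      have h₁ := (evaluationAdjunctionRight C j).homEquiv_unit (f := f j)
      rw [Equiv.apply_symm_apply] at h₁
      have h₂ : f j = Sigma.ι Q j ≫ Sigma.desc f := (Sigma.ι_desc f j).symm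
      have h₃ : (f j).app j = (Sigma.ι Q j).app j ≫ (Sigma.desc f).app j := by
        conv_lhs => rw [h₂, NatTrans.comp_app]
      have h₄ : Projective.π (X.obj j) = ((evaluationAdjunctionRight C j).unit.app _ ≫
          (Sigma.ι Q j).app j) ≫ (Sigma.desc f).app j := by
        rw [Category.assoc, ← h₃]
        exact h₁
      have h₅ : Epi (((evaluationAdjunctionRight C j).unit.app (Projective.over (X.obj j)) ≫
          (Sigma.ι Q j).app j) ≫ (Sigma.desc f).app j) := h₄ ▸ inferInstance
      exact epi_of_epi ((evaluationAdjunctionRight C j).unit.app (Projective.over (X.obj j)) ≫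
        (Sigma.ι Q j).app j) _
    have hP : Projective (∐ Q) := by
      refine ⟨fun {E Y} g e _ => ?_⟩
      refine ⟨Sigma.desc fun j => Projective.factorThru (Sigma.ι Q j ≫ g) e, ?_⟩
      refine Sigma.hom_ext _ _ fun j => ?_
      rw [Sigma.ι_desc_assoc, Projective.factorThru_comp]
    exact ⟨{ p := ∐ Q, f := Sigma.desc f, epi := NatTrans.epi_of_epi_app _ }⟩

end EnoughProjectives

/-! ### Closure properties of filtered representations -/

section FilteredClosure

variable {C : Type u} [Category.{v} C] [Abelian C] {𝒜 ℬ : ObjectProperty C}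

/-- The inclusion of the kernel extends, over zero, along the monomorphism of the extension; the
extension lands in the kernel again. -/
lemma extensionsSplit_kernel_of_rlp (ℱ : ObjectProperty C) [ℱ.IsClosedUnderIsomorphisms] {E F : C}
    {f : E ⟶ F} (hf : (monoWithCokernel ℱ).rlp f) {Z : C} (hZ : ℱ Z) :
    ExtensionsSplit Z (kernel f) := by
  intro V i p w hS
  have := hf i (monoWithCokernel_of_shortExact hS hZ)
  have sq : CommSq (kernel.ι f) i f 0 := ⟨by simp⟩
  refine ⟨kernel.lift f sq.lift sq.fac_right, ?_⟩
  rw [← cancel_mono (kernel.ι f), Category.assoc, kernel.lift_ι, sq.fac_left, Category.id_comp]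

/-- As the third vertical map is monic, the connecting morphism vanishes and the cokernels form a
short exact sequence. Closure of 𝒜 under kernels of epimorphisms, that is heredity, then applies. -/
lemma HereditaryPair.monoWithCokernel_of_snakeInput (h : HereditaryPair 𝒜 ℬ)
    (S : ShortComplex.SnakeInput C) [Mono S.L₁.f] [Epi S.L₂.g]
    (h₂ : monoWithCokernel 𝒜 S.v₁₂.τ₂) (h₃ : monoWithCokernel 𝒜 S.v₁₂.τ₃) :
    monoWithCokernel 𝒜 S.v₁₂.τ₁ := by
  have := h.isClosedUnderIsomorphisms_left
  have := h₂.1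
  have := h₃.1
  have : Mono S.v₁₂.τ₁ := by
    have : Mono (S.v₁₂.τ₁ ≫ S.L₂.f) := by
      rw [S.v₁₂.comm₁₂]
      infer_instance
    exact mono_of_mono _ S.L₂.f
  have hδ : S.δ = 0 := by
    have h₀ : S.v₀₁.τ₃ = 0 := by
      rw [← cancel_mono S.v₁₂.τ₃, zero_comp]
      exact S.w₀₂_τ₃
    have : IsZero S.L₀.X₃ := (IsZero.iff_id_eq_zero _).2 (by
      rw [← cancel_mono S.v₀₁.τ₃, zero_comp, Category.id_comp, h₀])
    exact this.eq_of_src _ _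
  have hf : Mono S.L₃.f := S.L₂'_exact.mono_g hδ
  have e₁ : (ShortComplex.mk _ _ S.w₁₃_τ₁).ShortExact :=
    { exact := S.exact_C₁_down, epi_g := S.epi_v₂₃_τ₁, mono_f := this }
  have e₂ : (ShortComplex.mk _ _ S.w₁₃_τ₂).ShortExact :=
    { exact := S.exact_C₂_down, epi_g := S.epi_v₂₃_τ₂, mono_f := h₂.1 }
  have e₃ : (ShortComplex.mk _ _ S.w₁₃_τ₃).ShortExact :=
    { exact := S.exact_C₃_down, epi_g := S.epi_v₂₃_τ₃, mono_f := h₃.1 }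
  have a₂ := prop_of_shortExact_of_monoWithCokernel e₂ h₂
  have a₃ := prop_of_shortExact_of_monoWithCokernel e₃ h₃
  exact monoWithCokernel_of_shortExact e₁ (h.left_kernel S.L₃ ⟨S.L₃_exact⟩ a₂ a₃)

/-- The monomorphisms with cokernel in `𝒜` are closed under kernels of epimorphisms. -/
lemma HereditaryPair.monoWithCokernel_τ₁ (h : HereditaryPair 𝒜 ℬ) {S₁ S₂ : ShortComplex C}
    (hS₁ : S₁.ShortExact) (hS₂ : S₂.ShortExact) (φ : S₁ ⟶ S₂) (h₂ : monoWithCokernel 𝒜 φ.τ₂)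
    (h₃ : monoWithCokernel 𝒜 φ.τ₃) : monoWithCokernel 𝒜 φ.τ₁ := by
  let S : ShortComplex.SnakeInput C :=
    { L₀ := kernel φ
      L₁ := S₁
      L₂ := S₂
      L₃ := cokernel φ
      v₀₁ := kernel.ι φ
      v₁₂ := φ
      v₂₃ := cokernel.π φ
      h₀ := kernelIsKernel φ
      h₃ := cokernelIsCokernel φ
      L₁_exact := hS₁.exact
      L₂_exact := hS₂.exact
      epi_L₁_g := hS₁.epi_g
      mono_L₂_f := hS₂.mono_f }
  have : Mono S.L₁.f := hS₁.mono_f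
  have : Epi S.L₂.g := hS₂.epi_g
  exact h.monoWithCokernel_of_snakeInput S h₂ h₃

lemma HereditaryPair.filteredRep_kernel (h : HereditaryPair 𝒜 ℬ)
    {S : ShortComplex (QuiverRep InfiniteLine C)} (hS : S.ShortExact) (h₂ : filteredRep 𝒜 S.X₂)
    (h₃ : filteredRep 𝒜 S.X₃) : filteredRep 𝒜 S.X₁ := fun j =>
  h.monoWithCokernel_τ₁ (hS.map_of_exact ((evaluation _ C).obj (vtx (j + 1))))
    (hS.map_of_exact ((evaluation _ C).obj (vtx j)))
    (S.mapNatTrans ((evaluation _ C).map (step j))) (h₂ j) (h₃ j)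

/-- Each map of X is a retract of the corresponding map of Y, and left lifting properties pass to
retracts. -/
lemma HereditaryPair.filteredRep_retract (h : HereditaryPair 𝒜 ℬ) {X Y : QuiverRep InfiniteLine C}
    (i : X ⟶ Y) (r : Y ⟶ X) (hir : i ≫ r = 𝟙 X) (hY : filteredRep 𝒜 Y) : filteredRep 𝒜 X := by
  intro j
  have hi : ∀ x, i.app x ≫ r.app x = 𝟙 _ := fun x => by
    rw [← NatTrans.comp_app, hir, NatTrans.id_app]
  let ρ : RetractArrow (X.map (step j)) (Y.map (step j)) :=
    { i := Arrow.homMk (i.app _) (i.app _) (i.naturality (step j)).symm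
      r := Arrow.homMk (r.app _) (r.app _) (r.naturality (step j)).symm
      retract := by
        ext
        · exact hi _
        · exact hi _ }
  have := hY j
  rw [← h.llp_eq] at this ⊢
  exact MorphismProperty.of_retract ρ this

lemma HereditaryPair.isClosedUnderIsomorphisms_filteredRep (h : HereditaryPair 𝒜 ℬ) :
    (filteredRep 𝒜).IsClosedUnderIsomorphisms where
  of_iso e hX := h.filteredRep_retract e.inv e.hom e.inv_hom_id hX

/-- Every representation is the quotient of a filtered one by a representation all of whose
extensions by filtered ones split. -/
lemma HereditaryPair.exists_filtered_precover [HasLimitsOfSize.{0, 0} C] [EnoughProjectives C]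
    (h : HereditaryPair 𝒜 ℬ) (X : QuiverRep InfiniteLine C) :
    ∃ (K F : QuiverRep InfiniteLine C) (i : K ⟶ F) (p : F ⟶ X) (w : i ≫ p = 0),
      filteredRep 𝒜 F ∧ (∀ Z, filteredRep 𝒜 Z → ExtensionsSplit Z K) ∧
        (ShortComplex.mk i p w).ShortExact := by
  have := h.isClosedUnderIsomorphisms_filteredRep
  obtain ⟨F, f, hF, hf, hf'⟩ := h.exists_filtered_cover X
  exact ⟨_, F, _, f, _, hF, fun Z hZ => extensionsSplit_kernel_of_rlp _ hf' hZ,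
    shortExact_kernel f⟩

end FilteredClosure

/-! ### Passage to the opposite category -/

section Duality

variable {D : Type u} [Category.{v} D] [Abelian D] {E : Type u'} [Category.{v'} E] [Abelian E]

lemma ExtensionsSplit.of_equivalence (e : D ≌ E) {A B : D}
    (h : ExtensionsSplit (e.functor.obj A) (e.functor.obj B)) : ExtensionsSplit A B := by
  intro V i p w hS
  obtain ⟨r, hr⟩ := h _ _ _ _ (hS.map_of_exact e.functor)
  refine ⟨e.functor.preimage r, e.functor.map_injective ?_⟩
  rw [e.functor.map_comp, e.functor.map_preimage, e.functor.map_id]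
  exact hr

/-- Transport of a special precovering class along a duality. -/
lemma isCompleteHereditaryCotorsionPair_of_duality [EnoughProjectives D] [EnoughInjectives D]
    (e : Dᵒᵖ ≌ E) (ℱ : ObjectProperty E) (𝒢 : ObjectProperty D)
    (h𝒢 : ∀ X, 𝒢 X ↔ ℱ (e.functor.obj (Opposite.op X)))
    (hretract : ∀ (X Y : E) (i : X ⟶ Y) (r : Y ⟶ X), i ≫ r = 𝟙 X → ℱ Y → ℱ X)
    (hker : ∀ S : ShortComplex E, S.ShortExact → ℱ S.X₂ → ℱ S.X₃ → ℱ S.X₁)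
    (hpre : ∀ X, ∃ (K F : E) (i : K ⟶ F) (p : F ⟶ X) (w : i ≫ p = 0),
      ℱ F ∧ (∀ Z, ℱ Z → ExtensionsSplit Z K) ∧ (ShortComplex.mk i p w).ShortExact) :
    IsCompleteHereditaryCotorsionPair (leftPerp 𝒢) 𝒢 := by
  have hiso : ∀ {X Y : E}, (X ≅ Y) → ℱ X → ℱ Y := fun α hX =>
    hretract _ _ α.inv α.hom α.inv_hom_id hX
  refine isCompleteHereditaryCotorsionPair_of_preenvelopes 𝒢 (fun X Y i r hir hY => ?_)
    (fun S hS h₁ h₂ => ?_) fun X => ?_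
  · rw [h𝒢] at hY ⊢
    refine hretract _ _ (e.functor.map r.op) (e.functor.map i.op) ?_ hY
    rw [← e.functor.map_comp, ← op_comp, hir, op_id, e.functor.map_id]
  · rw [h𝒢] at h₁ h₂ ⊢
    exact hker _ (hS.op.map_of_exact e.functor) h₂ h₁
  -- A special precover of the dual object, transported back and reversed, is a special preenvelope
  -- of X.
  · obtain ⟨K, F, i, p, w, hF, hK, hS⟩ := hpre (e.functor.obj (Opposite.op X))
    have hS' : (ShortComplex.mk (e.inverse.map i)
        (e.inverse.map p ≫ e.unitInv.app (Opposite.op X)) (by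
          rw [← Category.assoc, ← e.inverse.map_comp, w, e.inverse.map_zero,
            zero_comp])).ShortExact := by
      refine ShortComplex.shortExact_of_iso ?_ (hS.map_of_exact e.inverse)
      exact ShortComplex.isoMk (Iso.refl _) (Iso.refl _) (e.unitIso.symm.app (Opposite.op X))
        ((Category.id_comp _).trans (Category.comp_id _).symm) (Category.id_comp _)
    refine ⟨_, _, _, _, _, fun B hB => ?_, ?_, hS'.unop⟩
    · refine extVanishes_of_extensionsSplit (ExtensionsSplit.unop (.of_equivalence e ?_))
      exact extensionsSplit_congr_right (e.counitIso.app K).symm (hK _ ((h𝒢 B).1 hB))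
    · rw [h𝒢]
      exact hiso (e.counitIso.app F).symm hF

/-- The reflection of the infinite line. -/
def reflection : Paths InfiniteLine ⥤ (Paths InfiniteLine)ᵒᵖ :=
  Paths.lift
    { obj := fun i : ℤ => Opposite.op (vtx (-i))
      map := fun {i j : ℤ} a => (arrow (i := -j) (j := -i) (by have := a.down; omega)).op }

instance : reflection.Faithful where
  map_injective _ := Subsingleton.elim _ _

lemma le_of_hom {i j : ℤ} (f : vtx i ⟶ vtx j) : j ≤ i := toInt_le_of_path f

instance : reflection.Full where
  map_surjective {i j} f :=
    ⟨path (i := toInt i) (j := toInt j) (by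
      have := le_of_hom (i := -toInt j) (j := -toInt i) f.unop
      omega), Quiver.Hom.unop_inj (Subsingleton.elim _ _)⟩

instance : reflection.EssSurj where
  mem_essImage x := ⟨vtx (-(toInt x.unop)), ⟨eqToIso (congrArg Opposite.op
    (neg_neg (toInt x.unop) : (- - toInt x.unop) = toInt x.unop))⟩⟩

instance : reflection.IsEquivalence where

/-- The duality between the representations of the infinite line in a category and in its opposite
category. -/
def repDuality (C : Type u) [Category.{v} C] :
    (QuiverRep InfiniteLine C)ᵒᵖ ≌ QuiverRep InfiniteLine Cᵒᵖ :=
  (Functor.opUnopEquiv _ C).trans reflection.asEquivalence.symm.congrLeft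

variable {C : Type u} [Category.{v} C] [Abelian C] {𝒜 ℬ : ObjectProperty C}

lemma HereditaryPair.monoWithCokernel_op_iff (h : HereditaryPair 𝒜 ℬ) {X Y : C} (f : X ⟶ Y) :
    monoWithCokernel ℬ.op f.op ↔ epiWithKernel ℬ f := by
  have := h.op.isClosedUnderIsomorphisms_left
  refine ⟨fun hf => ?_, fun hf => ?_⟩
  · have := hf.1
    have : Epi f := ⟨fun a b hab =>
      Quiver.Hom.op_inj ((cancel_mono f.op).1 (Quiver.Hom.unop_inj hab))⟩
    exact ⟨this, prop_of_shortExact_of_monoWithCokernel (shortExact_kernel f).op hf⟩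
  · have := hf.1
    exact monoWithCokernel_of_shortExact (shortExact_kernel f).op hf.2

/-- The map of the dual representation at j+1 → j is the opposite of the map of X at -j → -(j+1). -/
lemma HereditaryPair.filteredRep_repDuality_iff (h : HereditaryPair 𝒜 ℬ)
    (X : QuiverRep InfiniteLine C) :
    filteredRep ℬ.op ((repDuality C).functor.obj (Opposite.op X)) ↔
      ∀ j : ℤ, epiWithKernel ℬ (X.map (step j)) := by
  have e : ∀ j : ℤ,
      monoWithCokernel ℬ.op (((repDuality C).functor.obj (Opposite.op X)).map (step j)) ↔
        epiWithKernel ℬ (X.map (arrow (i := -j) (j := -(j + 1)) (by ring))) := fun j => by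
    rw [← h.monoWithCokernel_op_iff,
      ← Subsingleton.elim (reflection.map (step j)).unop
        (arrow (i := -j) (j := -(j + 1)) (by ring))]
    exact Iff.rfl
  refine ⟨fun hX j => ?_, fun hX j => ?_⟩
  · have := hX (-(j + 1))
    rw [e] at this
    have key : ∀ {i k : ℤ} (hik : i = k + 1) (hi : i = j + 1), epiWithKernel ℬ (X.map (arrow hik)) →
        epiWithKernel ℬ (X.map (step j)) := by
      rintro _ k hik rfl hk
      obtain rfl : j = k := by omega
      exact hk
    exact key _ (by ring) this
  · rw [e]
    have key : ∀ {i k : ℤ} (hik : i = k + 1), epiWithKernel ℬ (X.map (arrow hik)) := by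
      rintro _ k rfl
      exact hX k
    exact key _

end Duality

end QuiverCotorsion

end

open QuiverCotorsion in
theorem theorem5 (R : Type u) [Ring R] (𝒜 ℬ : ObjectProperty (ModuleCat.{u} R))
    (h : IsCompleteHereditaryCotorsionPair 𝒜 ℬ) :
    IsCompleteHereditaryCotorsionPair
      (Phi 𝒜 : ObjectProperty (QuiverRep InfiniteLine (ModuleCat.{u} R)))
      (rightPerp (Phi 𝒜)) ∧
    IsCompleteHereditaryCotorsionPair
      (leftPerp (Psi ℬ))
      (Psi ℬ : ObjectProperty (QuiverRep InfiniteLine (ModuleCat.{u} R))) := by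
  have H := h.hereditaryPair
  have := H.isClosedUnderIsomorphisms_left
  have := H.isClosedUnderIsomorphisms_right
  have : EnoughProjectives (QuiverRep InfiniteLine (ModuleCat.{u} R)) := by
    have := hasColimitsOfSizeShrink.{0, 0, u, u} (ModuleCat.{u} R)
    exact enoughProjectives_functor
  -- Injective representations are dual to projective ones over the opposite category, which has
  -- enough projectives since there are enough injective modules.
  have : EnoughInjectives (QuiverRep InfiniteLine (ModuleCat.{u} R)) := by
    have : EnoughProjectives (QuiverRep InfiniteLine (ModuleCat.{u} R)ᵒᵖ) :=
      enoughProjectives_functor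
    have := (repDuality (ModuleCat.{u} R)).enoughProjectives_iff.2 this
    exact Injective.enoughInjectives_of_enoughProjectives_op
  constructor
  · have hΦ : (Phi 𝒜 : ObjectProperty (QuiverRep InfiniteLine (ModuleCat.{u} R))) =
        filteredRep 𝒜 := funext fun X => propext phi_iff_monoWithCokernel
    rw [hΦ]
    refine isCompleteHereditaryCotorsionPair_of_precovers _
      (fun X Y i r hir hY => H.filteredRep_retract i r hir hY)
      (fun S hS h₂ h₃ => H.filteredRep_kernel hS h₂ h₃) fun X => ?_
    obtain ⟨K, F, i, p, w, hF, hK, hS⟩ := H.exists_filtered_precover X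
    exact ⟨K, F, i, p, w, hF, fun Z hZ => extVanishes_of_extensionsSplit (hK Z hZ), hS⟩
  -- The second pair is obtained from the filtered covers for the opposite pair (ℬᵒᵖ, 𝒜ᵒᵖ).
  · exact isCompleteHereditaryCotorsionPair_of_duality (repDuality (ModuleCat.{u} R))
      (filteredRep ℬ.op) (Psi ℬ)
      (fun X => psi_iff_epiWithKernel.trans (H.filteredRep_repDuality_iff X).symm)
      (fun X Y i r hir hY => H.op.filteredRep_retract i r hir hY)
      (fun S hS h₂ h₃ => H.op.filteredRep_kernel hS h₂ h₃) H.op.exists_filtered_precover
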